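/- Let $\Lambda$ be a commutative local uniserial ring of length $n$ (its ideals form a chain, and $\Lambda$ has length $n$ as a module over itself; so $n\geq 1$), let $p$ be a generator of its maximal ideal and $k=\Lambda/(p)$ its residue field. Let $\mathcal S_2(\Lambda)$ be the category of pairs $(B;A)$, where $B$ is a finitely generated $\Lambda$-module and $A\subseteq B$ a submodule with $p^2A=0$; a morphism $(B;A)\to(D;C)$ is a $\Lambda$-linear map $f:B\to D$ with $f(A)\subseteq C$. For $0\leq m\leq \ell\leq n$ with $m\le 2$ and $\ell\geq 1$, the picket $P^\ell_m$ is the pair $(\Lambda/(p^\ell);\,p^{\ell-m}\Lambda/(p^\ell))$. For integers $s,t$ with $0\leq s-1<t-2\leq n-2$, let $Q^t_s$ be the pair $(\Lambda/(p^t)\oplus\Lambda/(p^s);\,\Lambda\cdot(p^{t-2},p^{s-1}))$. Let $\mathcal P_n$ be the poset consisting of the chain $n-1<n-2<\dots<1$ and of two further points $1',1''$, each incomparable to all other points. Let $\mathrm{rep}_k\mathcal P_n$ be the category of finite dimensional representations of $\mathcal P_n$: an object $V$ is a finite dimensional $k$-vector space $V^0$ with subspaces $V^i$ ($i\in\mathcal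 P_n$) such that $V^i\subseteq V^j$ whenever $i\le j$ in $\mathcal P_n$; a morphism $V\to W$ is a linear map $V^0\to W^0$ which maps each $V^i$ into $W^i$. Write $V'=V^{1'}$ and $V''=V^{1''}$. Let $\mathrm{rep}'_k\mathcal P_n$ be the full subcategory of those $V$ with $V^{n-1}\subseteq V'$ and $V'+V''=V^0$ (for $n=1$, $V^{n-1}$ is the total space $V^0$). For $0\le\ell<n$ and $\ell',\ell''\in\{0,1\}$, let $V_{\ell,\ell',\ell''}$ be the representation with total space $k$ in which $V^i=k$ if $1\leq i\leq\ell$, $V^i=0$ if $\ell<i\leq n-1$, $V'=k$ if $\ell'=1$, $V'=0$ if $\ell'=0$, $V''=k$ if $\ell''=1$ and $V''=0$ if $\ell''=0$. For $0\leq s<t<n$, let $W_{s,t}$ be the representation with total space $k\oplus k$ in which $V^i=k\oplus k$ for $1\leq i\leq s$, $V^i=k(1,1)$ for $s<i\leq t$, $V^i=0$ for $t<i\leq n-1$, $V'=k\oplus 0$ and $V''=0\oplus k$. For $(B;A)\in\mathcal S_2(\Lambda)$ put $A^-=\mathrm{rad}\,A=pA$ and $A^+=A+\mathrm{soc}\,B$,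 and for a submodule $C\subseteq B$ put $\widetilde C=((C\cap A^+)+A^-)/A^-$. Setting $V^0=A^+/A^-$, $V^\ell=\widetilde{\mathrm{rad}^\ell B}$ for $1\leq\ell\leq n-1$, $V'=\widetilde{\mathrm{soc}\,B}$ and $V''=\widetilde A$, and sending a morphism $(B;A)\to(D;C)$ to the induced map $A^+/A^-\to C^+/C^-$, defines a functor $F:\mathcal S_2(\Lambda)\to\mathrm{rep}_k\mathcal P_n$ with values in $\mathrm{rep}'_k\mathcal P_n$. Proposition. (1) There are isomorphisms $$F(P^\ell_0)\cong V_{\ell-1,1,0}\ (1\leq\ell\leq n),\qquad F(P^\ell_1)\cong V_{\ell-1,1,1}\ (1\leq\ell\leq n),$$ $$F(P^\ell_2)\cong V_{\ell-2,0,1}\ (2\leq\ell\leq n),\qquad F(Q^t_s)\cong W_{s-1,t-2}\ (0\leq s-1<t-2\leq n-2),$$ and the representations on the right hand sides are indecomposable. (2) The functor $F:\mathcal S_2(\Lambda)\to\mathrm{rep}'_k\mathcal P_n$ is dense: each object of $\mathrm{rep}'_k\mathcal P_n$ is isomorphic to $F(B;A)$ for some $(B;A)\in\mathcal S_2(\Lambda)$.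 (3) All the pairs $P^\ell_m$ ($m\le 2$, $m\leq\ell$, $1\leq\ell\leq n$) and $Q^t_s$ ($0\leq s-1<t-2\leq n-2$) are indecomposable in $\mathcal S_2(\Lambda)$, and they are pairwise nonisomorphic. -/

import Mathlib

open CategoryTheory CategoryTheory.Limits IsLocalRing

universe u

namespace BoundedPairs

/-- A commutative local ring `Λ` is uniserial of length `n`: its ideals form a chain, and `Λ` has
length `n` as a module over itself. -/
structure IsUniserialOfLength (Λ : Type u) [CommRing Λ] [IsLocalRing Λ] (n : ℕ) : Prop where
  total : ∀ I J : Ideal Λ, I ≤ J ∨ J ≤ I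
  length_eq : Module.length Λ Λ = n

theorem IsUniserialOfLength.isNoetherianRing {Λ : Type u} [CommRing Λ] [IsLocalRing Λ] {n : ℕ}
    (h : IsUniserialOfLength Λ n) : IsNoetherianRing Λ := by
  have h1 : Module.length Λ Λ ≠ ⊤ := by rw [h.length_eq]; exact ENat.natCast_ne_top n
  exact (isFiniteLength_iff_isNoetherian_isArtinian.mp (Module.length_ne_top_iff.mp h1)).1

theorem IsUniserialOfLength.pow_eq_bot {Λ : Type u} [CommRing Λ] [IsLocalRing Λ] {n : ℕ}
    (h : IsUniserialOfLength Λ n) : maximalIdeal Λ ^ n = ⊥ := by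
  by_contra hne
  have hN := h.isNoetherianRing
  have key : ∀ j, j ≤ n → ((j + 1 : ℕ) : ℕ∞) ≤ Order.height (maximalIdeal Λ ^ (n - j)) := by
    intro j
    induction j with
    | zero =>
      intro _
      have := Order.height_add_one_le (bot_lt_iff_ne_bot.mpr hne)
      simpa using this
    | succ j ih =>
      intro hj
      have h1 := ih (by omega)
      have hlt : maximalIdeal Λ ^ (n - j) < maximalIdeal Λ ^ (n - (j + 1)) := by
        refine lt_of_le_of_ne (Ideal.pow_le_pow_right (by omega)) ?_
        intro heq
        have hs : n - j = (n - (j + 1)) + 1 := by omega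
        have h0 : maximalIdeal Λ ^ (n - (j + 1)) = ⊥ := by
          refine Submodule.eq_bot_of_le_smul_of_le_jacobson_bot (maximalIdeal Λ) _
            (IsNoetherian.noetherian _) ?_ (IsLocalRing.maximalIdeal_le_jacobson _)
          rw [smul_eq_mul, ← pow_succ', ← hs, heq]
        apply hne
        rw [eq_bot_iff, ← h0]
        exact Ideal.pow_le_pow_right (by omega)
      have h2 := Order.height_add_one_le hlt
      refine le_trans ?_ h2
      push_cast at h1 ⊢
      gcongr
  have h1 := key n le_rfl
  simp only [Nat.sub_self, pow_zero, Ideal.one_eq_top] at h1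
  have h2 : Order.height (⊤ : Ideal Λ) = n := by
    rw [← h.length_eq]; exact (Module.length_eq_height (R := Λ) (M := Λ)).symm
  rw [h2] at h1
  have : n + 1 ≤ n := by exact_mod_cast h1
  omega

/-! ### Pairs consisting of a module and a bounded submodule -/

/-- The objects `(B; A)` of `S_m(Λ)`: a finitely generated `Λ`-module `B` and a submodule `A` which
is annihilated by `𝔪 ^ m`, that is, by `p ^ m` for any generator `p` of `𝔪`. -/
structure SubPair (Λ : Type u) [CommRing Λ] [IsLocalRing Λ] (m : ℕ) where
  B : Type u
  [addCommGroup : AddCommGroup B]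
  [module : Module Λ B]
  [finite : Module.Finite Λ B]
  A : Submodule Λ B
  bounded : maximalIdeal Λ ^ m • A = ⊥

attribute [instance] SubPair.addCommGroup SubPair.module SubPair.finite

namespace SubPair

variable {Λ : Type u} [CommRing Λ] [IsLocalRing Λ] {m : ℕ}

/-- The morphisms `(B; A) → (D; C)`: the `Λ`-linear maps `f : B → D` with `f(A) ⊆ C`. -/
def homs (X Y : SubPair Λ m) : AddSubgroup (X.B →ₗ[Λ] Y.B) where
  carrier := {f | ∀ a ∈ X.A, f a ∈ Y.A}
  add_mem' hf hg a ha := Y.A.add_mem (hf a ha) (hg a ha)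
  zero_mem' _ _ := Y.A.zero_mem
  neg_mem' hf a ha := Y.A.neg_mem (hf a ha)

instance : Category.{u} (SubPair Λ m) where
  Hom X Y := homs X Y
  id _ := ⟨LinearMap.id, fun _ ha => ha⟩
  comp f g := ⟨g.1.comp f.1, fun a ha => g.2 _ (f.2 a ha)⟩

instance : Preadditive (SubPair Λ m) where
  homGroup X Y := inferInstanceAs (AddCommGroup (homs X Y))
  add_comp _ _ _ f f' g := Subtype.ext (LinearMap.comp_add f.1 f'.1 g.1)
  comp_add _ _ _ f g g' := Subtype.ext (LinearMap.add_comp f.1 g'.1 g.1)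

/-- The direct sum `(B ⊕ D; A ⊕ C)`. -/
def directSum (X Y : SubPair Λ m) : SubPair Λ m where
  B := X.B × Y.B
  A := X.A.prod Y.A
  bounded := by
    rw [eq_bot_iff, Submodule.smul_le]
    rintro r hr ⟨a, c⟩ ⟨ha, hc⟩
    have h1 : r • a ∈ (⊥ : Submodule Λ X.B) := X.bounded ▸ Submodule.smul_mem_smul hr ha
    have h2 : r • c ∈ (⊥ : Submodule Λ Y.B) := Y.bounded ▸ Submodule.smul_mem_smul hr hc
    rw [Submodule.mem_bot] at h1 h2 ⊢
    exact Prod.ext h1 h2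

/-- The direct sum with its canonical inclusions and projections. -/
def bicone (X Y : SubPair Λ m) : BinaryBicone X Y where
  pt := directSum X Y
  fst := ⟨LinearMap.fst Λ X.B Y.B, fun _ h => h.1⟩
  snd := ⟨LinearMap.snd Λ X.B Y.B, fun _ h => h.2⟩
  inl := ⟨LinearMap.inl Λ X.B Y.B, fun _ h => ⟨h, Y.A.zero_mem⟩⟩
  inr := ⟨LinearMap.inr Λ X.B Y.B, fun _ h => ⟨X.A.zero_mem, h⟩⟩
  inl_fst := Subtype.ext (LinearMap.ext fun _ => rfl)
  inl_snd := Subtype.ext (LinearMap.ext fun _ => rfl)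
  inr_fst := Subtype.ext (LinearMap.ext fun _ => rfl)
  inr_snd := Subtype.ext (LinearMap.ext fun _ => rfl)

instance : HasBinaryBiproducts (SubPair Λ m) where
  has_binary_biproduct X Y := hasBinaryBiproduct_of_total (bicone X Y) <|
    Subtype.ext <| LinearMap.ext fun x =>
      (Prod.ext (add_zero _) (zero_add _) : ((x.1 + 0, 0 + x.2) : X.B × Y.B) = x)

variable {p : Λ}

/-- The picket `P^ℓ_m = (Λ/(p^ℓ); (p^{ℓ-m})/(p^ℓ))`, where `m ≤ ℓ`, regarded as an object of
`S_M(Λ)` for `m ≤ M`. -/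
def picket (hp : maximalIdeal Λ = Ideal.span {p}) (ℓ m : ℕ) {M : ℕ} (hm : m ≤ M) :
    SubPair Λ M where
  B := Λ ⧸ Ideal.span {p ^ ℓ}
  A := Submodule.span Λ {Ideal.Quotient.mk (Ideal.span {p ^ ℓ}) (p ^ (ℓ - m))}
  bounded := by
    rw [hp, Ideal.span_singleton_pow, Ideal.span, Submodule.span_smul_span,
      Set.singleton_smul_singleton, Submodule.span_singleton_eq_bot, Algebra.smul_def, Ideal.Quotient.algebraMap_eq,
      ← map_mul, Ideal.Quotient.eq_zero_iff_mem, Ideal.mem_span_singleton, ← pow_add]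
    exact pow_dvd_pow p (by omega)

/-- The pair `Q^t_s = (Λ/(p^t) ⊕ Λ/(p^s); Λ(p^{t-2}, p^{s-1}))`, where `1 ≤ s` and `2 ≤ t`. -/
def pairQ (hp : maximalIdeal Λ = Ideal.span {p}) (t s : ℕ) : SubPair Λ 2 where
  B := (Λ ⧸ Ideal.span {p ^ t}) × (Λ ⧸ Ideal.span {p ^ s})
  A := Submodule.span Λ {(Ideal.Quotient.mk (Ideal.span {p ^ t}) (p ^ (t - 2)),
    Ideal.Quotient.mk (Ideal.span {p ^ s}) (p ^ (s - 1)))}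
  bounded := by
    rw [hp, Ideal.span_singleton_pow, Ideal.span, Submodule.span_smul_span,
      Set.singleton_smul_singleton, Submodule.span_singleton_eq_bot, Prod.smul_mk, Prod.mk_eq_zero]
    constructor <;>
    · rw [Algebra.smul_def, Ideal.Quotient.algebraMap_eq, ← map_mul,
        Ideal.Quotient.eq_zero_iff_mem, Ideal.mem_span_singleton, ← pow_add]
      exact pow_dvd_pow p (by omega)

/-- The indices of the pickets `P^ℓ_m` with `m ≤ 2` and of the pairs `Q^t_s` over a ring of
length `n`. -/
inductive Index (n : ℕ) : Type
  | picket (ℓ m : ℕ) (one_le : 1 ≤ ℓ) (le_n : ℓ ≤ n) (le_len : m ≤ ℓ) (le_two : m ≤ 2) : Index n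
  | pairQ (t s : ℕ) (one_le : 1 ≤ s) (lt : s - 1 < t - 2) (le_n : t ≤ n) : Index n

/-- The picket or the pair `Q^t_s` with the given index. -/
def ofIndex (hp : maximalIdeal Λ = Ideal.span {p}) {n : ℕ} : Index n → SubPair Λ 2
  | .picket ℓ m _ _ _ h => picket hp ℓ m h
  | .pairQ t s _ _ _ => pairQ hp t s

end SubPair

/-! ### Representations of the poset `P_n` -/

/-- The poset `P_n`: the chain `n-1 < n-2 < ⋯ < 1` together with two points `1'`, `1''` which are
incomparable to all other points. -/
inductive Poset (n : ℕ) : Type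
  | chain (i : ℕ) (one_le : 1 ≤ i) (lt : i < n) : Poset n
  | prime : Poset n
  | dprime : Poset n

/-- The order relation of `P_n`. -/
def Poset.rel {n : ℕ} : Poset n → Poset n → Prop
  | .chain i _ _, .chain j _ _ => j ≤ i
  | .prime, .prime => True
  | .dprime, .dprime => True
  | _, _ => False

instance (n : ℕ) : PartialOrder (Poset n) where
  le := Poset.rel
  le_refl a := by cases a <;> simp [Poset.rel]
  le_trans a b c hab hbc := by
    cases a <;> cases b <;> cases c <;> grind [Poset.rel]
  le_antisymm a b hab hba := by
    cases a <;> cases b <;> grind [Poset.rel]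

/-- A (finite dimensional) `k`-linear representation of `P_n`: a vector space with an order
preserving family of subspaces. -/
structure Rep (k : Type u) [Field k] (n : ℕ) where
  V : Type u
  [addCommGroup : AddCommGroup V]
  [module : Module k V]
  [finite : FiniteDimensional k V]
  sub : Poset n →o Submodule k V

attribute [instance] Rep.addCommGroup Rep.module Rep.finite

namespace Rep

variable {k : Type u} [Field k] {n : ℕ}

/-- The morphisms of representations: linear maps of the total spaces which preserve the
subspaces. -/
def homs (V W : Rep k n) : AddSubgroup (V.V →ₗ[k] W.V) where
  carrier := {f | ∀ i, ∀ v ∈ V.sub i, f v ∈ W.sub i}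
  add_mem' hf hg i v hv := (W.sub i).add_mem (hf i v hv) (hg i v hv)
  zero_mem' i _ _ := (W.sub i).zero_mem
  neg_mem' hf i v hv := (W.sub i).neg_mem (hf i v hv)

instance : Category.{u} (Rep k n) where
  Hom V W := homs V W
  id _ := ⟨LinearMap.id, fun _ _ hv => hv⟩
  comp f g := ⟨g.1.comp f.1, fun i v hv => g.2 i _ (f.2 i v hv)⟩

instance : Preadditive (Rep k n) where
  homGroup V W := inferInstanceAs (AddCommGroup (homs V W))
  add_comp _ _ _ f f' g := Subtype.ext (LinearMap.comp_add f.1 f'.1 g.1)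
  comp_add _ _ _ f g g' := Subtype.ext (LinearMap.add_comp f.1 g'.1 g.1)

/-- The direct sum of two representations. -/
def directSum (V W : Rep k n) : Rep k n where
  V := V.V × W.V
  sub := ⟨fun i => (V.sub i).prod (W.sub i), fun _ _ h =>
    Submodule.prod_mono (V.sub.monotone h) (W.sub.monotone h)⟩

/-- The direct sum with its canonical inclusions and projections. -/
def bicone (V W : Rep k n) : BinaryBicone V W where
  pt := directSum V W
  fst := ⟨LinearMap.fst k V.V W.V, fun _ _ h => h.1⟩
  snd := ⟨LinearMap.snd k V.V W.V, fun _ _ h => h.2⟩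
  inl := ⟨LinearMap.inl k V.V W.V, fun i _ h => ⟨h, (W.sub i).zero_mem⟩⟩
  inr := ⟨LinearMap.inr k V.V W.V, fun i _ h => ⟨(V.sub i).zero_mem, h⟩⟩
  inl_fst := Subtype.ext (LinearMap.ext fun _ => rfl)
  inl_snd := Subtype.ext (LinearMap.ext fun _ => rfl)
  inr_fst := Subtype.ext (LinearMap.ext fun _ => rfl)
  inr_snd := Subtype.ext (LinearMap.ext fun _ => rfl)

instance : HasBinaryBiproducts (Rep k n) where
  has_binary_biproduct V W := hasBinaryBiproduct_of_total (bicone V W) <|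
    Subtype.ext <| LinearMap.ext fun x =>
      (Prod.ext (add_zero _) (zero_add _) : ((x.1 + 0, 0 + x.2) : V.V × W.V) = x)

/-- The space `V^i` for `0 ≤ i ≤ n-1`, where `V^0` is the total space. -/
def level (V : Rep k n) (i : ℕ) : Submodule k V.V :=
  if h : 1 ≤ i ∧ i < n then V.sub (.chain i h.1 h.2) else ⊤

/-- The objects of `rep'_k P_n`: the representations with `V^{n-1} ⊆ V'` and `V' + V'' = V^0`. -/
def restricted (k : Type u) [Field k] (n : ℕ) : ObjectProperty (Rep k n) := fun V =>
  V.level (n - 1) ≤ V.sub .prime ∧ V.sub .prime ⊔ V.sub .dprime = ⊤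

/-- The representation `V_{ℓ,ℓ',ℓ''}` with total space `k`. -/
def repV (k : Type u) [Field k] (n : ℕ) (ℓ : ℕ) (ℓ' ℓ'' : Fin 2) : Rep k n where
  V := k
  sub :=
    { toFun := fun x => match x with
        | .chain i _ _ => if i ≤ ℓ then ⊤ else ⊥
        | .prime => if ℓ' = 1 then ⊤ else ⊥
        | .dprime => if ℓ'' = 1 then ⊤ else ⊥
      monotone' := by
        intro a b hab
        change Poset.rel a b at hab
        cases a <;> cases b <;> simp only [Poset.rel] at hab <;> try exact le_rfl
        dsimp only
        split_ifs <;> first | exact bot_le | exact le_top | omega }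

/-- The representation `W_{s,t}` with total space `k ⊕ k`. -/
def repW (k : Type u) [Field k] (n : ℕ) (s t : ℕ) : Rep k n where
  V := k × k
  sub :=
    { toFun := fun x => match x with
        | .chain i _ _ => if i ≤ s then ⊤ else if i ≤ t then Submodule.span k {(1, 1)} else ⊥
        | .prime => Submodule.prod ⊤ ⊥
        | .dprime => Submodule.prod ⊥ ⊤
      monotone' := by
        intro a b hab
        change Poset.rel a b at hab
        cases a <;> cases b <;> simp only [Poset.rel] at hab <;> try exact le_rfl
        dsimp only
        split_ifs <;> first | exact bot_le | exact le_top | exact le_rfl | omega }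

end Rep

/-! ### The functor `F` -/

namespace SubPair

variable {Λ : Type u} [CommRing Λ] [IsLocalRing Λ]

/-- The socle of a module over the local ring `Λ`: the elements annihilated by `𝔪`. -/
abbrev soc (Λ : Type u) [CommRing Λ] [IsLocalRing Λ] (B : Type u) [AddCommGroup B] [Module Λ B] :
    Submodule Λ B :=
  Submodule.torsionBySet Λ B (maximalIdeal Λ : Set Λ)

/-- `rad^ℓ B = 𝔪^ℓ B`. -/
abbrev radPow (Λ : Type u) [CommRing Λ] [IsLocalRing Λ] (B : Type u) [AddCommGroup B] [Module Λ B]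
    (ℓ : ℕ) : Submodule Λ B :=
  maximalIdeal Λ ^ ℓ • (⊤ : Submodule Λ B)

/-- `A⁻ = rad A = 𝔪 A`. -/
def minus (X : SubPair Λ 2) : Submodule Λ X.B := maximalIdeal Λ • X.A

/-- `A⁺ = A + soc B`. -/
def plus (X : SubPair Λ 2) : Submodule Λ X.B := X.A ⊔ soc Λ X.B

/-- The total space `A⁺ / A⁻`. -/
abbrev Total (X : SubPair Λ 2) : Type u := X.plus ⧸ X.minus.submoduleOf X.plus

theorem isTorsion_total (X : SubPair Λ 2) :
    Module.IsTorsionBySet Λ X.Total (maximalIdeal Λ : Set Λ) := by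
  rintro y ⟨r, hr⟩
  obtain ⟨⟨x, hx⟩, rfl⟩ := Submodule.Quotient.mk_surjective _ y
  change Submodule.Quotient.mk (r • (⟨x, hx⟩ : X.plus)) = 0
  rw [Submodule.Quotient.mk_eq_zero, Submodule.submoduleOf, Submodule.mem_comap]
  change r • x ∈ X.minus
  obtain ⟨a, ha, s, hs, rfl⟩ := Submodule.mem_sup.mp hx
  rw [smul_add, (Submodule.mem_torsionBySet_iff _ _).mp hs ⟨r, hr⟩, add_zero]
  exact Submodule.smul_mem_smul hr ha

/-- `A⁺ / A⁻` as a vector space over the residue field. -/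
noncomputable instance (X : SubPair Λ 2) : Module (ResidueField Λ) X.Total :=
  Module.IsTorsionBySet.module X.isTorsion_total

instance (X : SubPair Λ 2) : IsScalarTower Λ (ResidueField Λ) X.Total :=
  Module.IsTorsionBySet.isScalarTower (S := Λ) X.isTorsion_total

/-- A `Λ`-submodule of `A⁺ / A⁻` as a subspace. -/
def toSubspace (X : SubPair Λ 2) (N : Submodule Λ X.Total) :
    Submodule (ResidueField Λ) X.Total where
  carrier := N
  add_mem' := N.add_mem
  zero_mem' := N.zero_mem
  smul_mem' c x hx := by
    obtain ⟨r, rfl⟩ := residue_surjective c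
    have h : residue Λ r • x = r • x := algebraMap_smul (ResidueField Λ) r x
    rw [h]
    exact N.smul_mem r hx

/-- The subspace `((C ∩ A⁺) + A⁻) / A⁻` of `A⁺ / A⁻`. -/
def tilde (X : SubPair Λ 2) (C : Submodule Λ X.B) : Submodule (ResidueField Λ) X.Total :=
  X.toSubspace ((C.submoduleOf X.plus).map (X.minus.submoduleOf X.plus).mkQ)

theorem tilde_mono (X : SubPair Λ 2) {C D : Submodule Λ X.B} (h : C ≤ D) :
    X.tilde C ≤ X.tilde D :=
  Submodule.map_mono (f := (X.minus.submoduleOf X.plus).mkQ)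
    (Submodule.comap_mono (f := X.plus.subtype) h)

theorem finite_total [IsNoetherianRing Λ] (X : SubPair Λ 2) :
    FiniteDimensional (ResidueField Λ) X.Total := by
  have : IsNoetherian Λ X.B := isNoetherian_of_isNoetherianRing_of_finite Λ X.B
  exact Module.Finite.of_restrictScalars_finite Λ (ResidueField Λ) X.Total

theorem minus_map {X Y : SubPair Λ 2} (f : homs X Y) : X.minus ≤ Y.minus.comap f.1 :=
  Submodule.smul_le.mpr fun r hr a ha => by
    rw [Submodule.mem_comap, map_smul]
    exact Submodule.smul_mem_smul hr (f.2 a ha)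

theorem soc_map {B D : Type u} [AddCommGroup B] [AddCommGroup D] [Module Λ B] [Module Λ D]
    (f : B →ₗ[Λ] D) : soc Λ B ≤ (soc Λ D).comap f := by
  intro b hb
  rw [Submodule.mem_comap, Submodule.mem_torsionBySet_iff]
  intro r
  rw [← map_smul, (Submodule.mem_torsionBySet_iff _ _).mp hb r, map_zero]

theorem radPow_map {B D : Type u} [AddCommGroup B] [AddCommGroup D] [Module Λ B] [Module Λ D]
    (f : B →ₗ[Λ] D) (ℓ : ℕ) : radPow Λ B ℓ ≤ (radPow Λ D ℓ).comap f :=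
  Submodule.smul_le.mpr fun r hr a _ => by
    rw [Submodule.mem_comap, map_smul]
    exact Submodule.smul_mem_smul hr trivial

theorem plus_map {X Y : SubPair Λ 2} (f : homs X Y) : X.plus ≤ Y.plus.comap f.1 :=
  sup_le (fun a ha => Submodule.mem_sup_left (f.2 a ha))
    (fun _ hb => Submodule.mem_sup_right (soc_map f.1 hb))

/-- The map `A⁺ / A⁻ → C⁺ / C⁻` induced by a morphism `(B; A) → (D; C)`. -/
noncomputable def totalMap {X Y : SubPair Λ 2} (f : homs X Y) : X.Total →ₗ[ResidueField Λ] Y.Total :=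
  LinearMap.extendScalarsOfSurjective (R := Λ) residue_surjective
    (Submodule.mapQ (X.minus.submoduleOf X.plus) (Y.minus.submoduleOf Y.plus)
      (f.1.restrict (plus_map f)) (fun _ hx => minus_map f hx))

theorem totalMap_mk {X Y : SubPair Λ 2} (f : homs X Y) (x : X.plus) :
    totalMap f (Submodule.Quotient.mk x) = Submodule.Quotient.mk ⟨f.1 x, plus_map f x.2⟩ := rfl

theorem totalMap_tilde {X Y : SubPair Λ 2} (f : homs X Y) {C : Submodule Λ X.B}
    {D : Submodule Λ Y.B} (h : C ≤ D.comap f.1) :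
    ∀ v ∈ X.tilde C, totalMap f v ∈ Y.tilde D := by
  rintro _ ⟨x, hx, rfl⟩
  exact ⟨⟨f.1 x, plus_map f x.2⟩, h hx, rfl⟩

/-- The submodules of `B` which give rise to the subspaces of `F(B; A)`. -/
def source (X : SubPair Λ 2) {n : ℕ} : Poset n → Submodule Λ X.B
  | .chain ℓ _ _ => radPow Λ X.B ℓ
  | .prime => soc Λ X.B
  | .dprime => X.A

theorem source_mono (X : SubPair Λ 2) {n : ℕ} {a b : Poset n} (h : a ≤ b) :
    X.source a ≤ X.source b := by
  change Poset.rel a b at h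
  cases a <;> cases b <;> simp only [Poset.rel] at h <;> try exact le_rfl
  exact Submodule.smul_mono_left (Ideal.pow_le_pow_right h)

theorem source_map {X Y : SubPair Λ 2} {n : ℕ} (f : homs X Y) (a : Poset n) :
    X.source a ≤ (Y.source a).comap f.1 := by
  cases a with
  | chain ℓ _ _ => exact radPow_map f.1 ℓ
  | prime => exact soc_map f.1
  | dprime => exact f.2

end SubPair

section Functor

variable {Λ : Type u} [CommRing Λ] [IsLocalRing Λ] {n : ℕ}

/-- The functor `F : S_2(Λ) ⥤ rep_k P_n`. -/
noncomputable def F (hΛ : IsUniserialOfLength Λ n) : SubPair Λ 2 ⥤ Rep (ResidueField Λ) n where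
  obj X :=
    { V := X.Total
      finite := have := hΛ.isNoetherianRing; X.finite_total
      sub := ⟨fun a => X.tilde (X.source a), fun _ _ h => X.tilde_mono (X.source_mono h)⟩ }
  map f := ⟨SubPair.totalMap f, fun a => SubPair.totalMap_tilde f (SubPair.source_map f a)⟩
  map_id X := Subtype.ext <| LinearMap.ext fun x => by
    obtain ⟨x, rfl⟩ := Submodule.Quotient.mk_surjective _ x
    rfl
  map_comp f g := Subtype.ext <| LinearMap.ext fun x => by
    obtain ⟨x, rfl⟩ := Submodule.Quotient.mk_surjective _ x
    rfl

theorem F_restricted (hΛ : IsUniserialOfLength Λ n) (X : SubPair Λ 2) :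
    Rep.restricted (ResidueField Λ) n ((F hΛ).obj X) := by
  have hrad : ∀ i, n ≤ i + 1 → SubPair.radPow Λ X.B i ≤ SubPair.soc Λ X.B := by
    intro i hi
    refine Submodule.smul_le.mpr fun r hr b _ => ?_
    rw [Submodule.mem_torsionBySet_iff]
    rintro ⟨s, hs⟩
    have h0 : s * r ∈ maximalIdeal Λ ^ n :=
      Ideal.pow_le_pow_right hi (by rw [pow_succ']; exact Ideal.mul_mem_mul hs hr)
    rw [hΛ.pow_eq_bot, Ideal.mem_bot] at h0
    change s • r • b = 0
    rw [smul_smul, h0, zero_smul]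
  have htop : n ≤ 1 → X.tilde (SubPair.soc Λ X.B) = ⊤ := by
    intro hn
    have hs : SubPair.soc Λ X.B = ⊤ := by
      rw [eq_top_iff]
      refine le_trans ?_ (hrad 0 (by omega))
      simp [SubPair.radPow]
    rw [eq_top_iff]
    intro v _
    obtain ⟨x, rfl⟩ := Submodule.Quotient.mk_surjective _ v
    exact ⟨x, show (x : X.B) ∈ SubPair.soc Λ X.B by rw [hs]; trivial, rfl⟩
  constructor
  · unfold Rep.level
    split_ifs with h
    · exact X.tilde_mono (hrad _ (by omega))
    · exact (htop (by omega)).ge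
  · rw [eq_top_iff]
    intro v _
    obtain ⟨⟨x, hx⟩, rfl⟩ := Submodule.Quotient.mk_surjective _ v
    obtain ⟨a, ha, s, hs, rfl⟩ := Submodule.mem_sup.mp hx
    refine Submodule.mem_sup.mpr ⟨Submodule.Quotient.mk ⟨s, Submodule.mem_sup_right hs⟩,
      ⟨⟨s, Submodule.mem_sup_right hs⟩, hs, rfl⟩,
      Submodule.Quotient.mk ⟨a, Submodule.mem_sup_left ha⟩,
      ⟨⟨a, Submodule.mem_sup_left ha⟩, ha, rfl⟩, ?_⟩
    refine (Submodule.Quotient.mk_add _).symm.trans (congrArg _ (Subtype.ext ?_))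
    exact add_comm s a

/-- The functor `F`, regarded as a functor `S_2(Λ) ⥤ rep'_k P_n`. -/
noncomputable def F' (hΛ : IsUniserialOfLength Λ n) :
    SubPair Λ 2 ⥤ (Rep.restricted (ResidueField Λ) n).FullSubcategory :=
  (Rep.restricted (ResidueField Λ) n).lift (F hΛ) (F_restricted hΛ)

end Functor

end BoundedPairs

open BoundedPairs

/-! The functor `F` is additive and reflects zero objects (`isZero_of_F_obj`): if `A⁺ = A⁻`, then `A
= pA`, hence `A = p²A = 0`, hence `soc B = 0` and `B = 0`. So a pair is indecomposable as soon as
its image is, and pairs with nonisomorphic images are nonisomorphic. Part (3) thus reduces to the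
values in (1), which are computed by divisibility in `Λ`: the length of `Λ` enters through `p ^ j ∤
p ^ i` for `i < j ≤ n`. On the representation side, the listed objects have only scalar
endomorphisms, and the dimensions of their total spaces and subspaces tell them apart.

Since `F` preserves biproducts, density follows by induction on the dimension once every nonzero `V`
in `rep'` has a listed direct summand (`exists_section_of_restricted`). Let `V^t` be the last
nonzero term of the chain. A nonzero vector of `V^t` in `V'` or in `V''` yields a one-dimensional
summand. Otherwise a nonzero `x ∈ V^t` is written as a vector `y ∈ V'` plus a vector of `V''`, with
`y` as deep in the chain as possible, say in `V^s`; then `y` and `x - y` span a summand `W_{s,t}`.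
-/

namespace BoundedPairs

/-! ### Divisibility by powers of the generator of the maximal ideal -/

section Ring

variable {Λ : Type u} [CommRing Λ] [IsLocalRing Λ] {n : ℕ} {p : Λ}

/-- Multiplication by `p ^ i` maps `Λ/𝔪` onto a submodule `N` of `Λ/(p ^ (i+1))` of length at most
one, and the quotient by `N` is an image of `Λ/(p ^ i)`. -/
theorem length_quotient_span_pow_le (hp : maximalIdeal Λ = Ideal.span {p}) (i : ℕ) :
    Module.length Λ (Λ ⧸ Ideal.span {p ^ i}) ≤ i := by
  induction i with
  | zero =>
    have : Subsingleton (Λ ⧸ Ideal.span {p ^ 0}) := by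
      rw [Ideal.Quotient.subsingleton_iff, pow_zero, Ideal.span_singleton_one]
    rw [Module.length_eq_zero]; simp
  | succ i ih =>
    have hμ : maximalIdeal Λ ≤ Submodule.comap
        (LinearMap.mulLeft Λ (p ^ i)) (Ideal.span {p ^ (i + 1)}) := by
      rw [hp, Ideal.span_le, Set.singleton_subset_iff]
      change p ^ i * p ∈ Ideal.span {p ^ (i + 1)}
      rw [← pow_succ]
      exact Ideal.mem_span_singleton_self _
    let N := LinearMap.range (Submodule.mapQ _ _ _ hμ)
    have h1 : Module.length Λ N ≤ 1 := by
      have hs : IsSimpleModule Λ (Λ ⧸ maximalIdeal Λ) :=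
        isSimpleModule_iff_isCoatom.mpr (IsLocalRing.maximalIdeal.isMaximal Λ).out
      rw [← Module.length_eq_one Λ (Λ ⧸ maximalIdeal Λ)]
      exact Module.length_le_of_surjective _ (LinearMap.surjective_rangeRestrict
        (Submodule.mapQ _ _ _ hμ))
    have h2 : Module.length Λ ((Λ ⧸ Ideal.span {p ^ (i + 1)}) ⧸ N) ≤ i := by
      refine le_trans ?_ ih
      have hle : Ideal.span {p ^ i} ≤
          LinearMap.ker (N.mkQ ∘ₗ (Ideal.span {p ^ (i + 1)}).mkQ) := by
        rw [Ideal.span_le, Set.singleton_subset_iff]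
        refine LinearMap.mem_ker.mpr ((Submodule.Quotient.mk_eq_zero _).mpr ?_)
        refine ⟨Submodule.Quotient.mk 1, ?_⟩
        change Submodule.Quotient.mk (p ^ i * 1) = _
        rw [mul_one]; rfl
      refine Module.length_le_of_surjective (Submodule.liftQ _ _ hle) ?_
      rw [← LinearMap.range_eq_top, Submodule.range_liftQ, LinearMap.range_eq_top]
      exact (Submodule.mkQ_surjective _).comp (Submodule.mkQ_surjective _)
    rw [Module.length_eq_add_of_exact N.subtype N.mkQ N.injective_subtype N.mkQ_surjective
      (LinearMap.exact_subtype_mkQ N), add_comm]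
    push_cast
    exact add_le_add h2 h1

namespace IsUniserialOfLength

theorem pow_ne_zero (h : IsUniserialOfLength Λ n) (hp : maximalIdeal Λ = Ideal.span {p})
    {i : ℕ} (hi : i < n) : p ^ i ≠ 0 := by
  intro h0
  have h1 := length_quotient_span_pow_le hp i
  have e : (Λ ⧸ Ideal.span {p ^ i}) ≃ₗ[Λ] Λ :=
    (Submodule.quotEquivOfEqBot _ (by rw [h0]; simp))
  rw [e.length_eq, h.length_eq] at h1
  have : n ≤ i := by exact_mod_cast h1
  omega

/-- From `p ^ i = p ^ j * c` one gets `p ^ i * (1 - p ^ (j - i) * c) = 0`, where the second factor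
is a unit. -/
theorem not_pow_dvd_pow (h : IsUniserialOfLength Λ n) (hp : maximalIdeal Λ = Ideal.span {p})
    {i j : ℕ} (hij : i < j) (hj : j ≤ n) : ¬ p ^ j ∣ p ^ i := by
  rintro ⟨c, hc⟩
  apply h.pow_ne_zero hp (lt_of_lt_of_le hij hj)
  have hpm : p ^ (j - i) * c ∈ maximalIdeal Λ := by
    rw [hp, Ideal.mem_span_singleton]
    exact (dvd_pow_self p (by omega)).mul_right c
  have hu : IsUnit (1 - p ^ (j - i) * c) := by
    by_contra hn
    have := (maximalIdeal Λ).add_mem ((mem_maximalIdeal _).mpr hn) hpm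
    rw [sub_add_cancel] at this
    exact (mem_maximalIdeal (1 : Λ)).mp this isUnit_one
  rw [← hu.mul_left_eq_zero, mul_sub, mul_one, sub_eq_zero]
  rw [← mul_assoc, ← pow_add, Nat.add_sub_cancel' hij.le, ← hc]

theorem dvd_of_pow_dvd_mul_pow (h : IsUniserialOfLength Λ n)
    (hp : maximalIdeal Λ = Ideal.span {p}) {i j : ℕ} (hij : i < j) (hj : j ≤ n) {a : Λ}
    (ha : p ^ j ∣ a * p ^ i) : p ∣ a := by
  by_contra hn
  rw [← Ideal.mem_span_singleton, ← hp, mem_maximalIdeal, mem_nonunits_iff, not_not] at hn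
  rw [hn.dvd_mul_left] at ha
  exact h.not_pow_dvd_pow hp hij hj ha

/-- This determines the socle of `Λ/(p ^ j)`. Factors `p` are extracted from `a` one at a time: if
`a = p ^ i * c` with `i + 1 < j`, then `c` cannot be a unit. -/
theorem pow_pred_dvd_of_pow_dvd_mul (h : IsUniserialOfLength Λ n)
    (hp : maximalIdeal Λ = Ideal.span {p}) {j : ℕ} (hj : j ≤ n) {a : Λ}
    (ha : p ^ j ∣ p * a) : p ^ (j - 1) ∣ a := by
  suffices H : ∀ i, i ≤ j - 1 → p ^ i ∣ a from H _ le_rfl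
  intro i
  induction i with
  | zero => simp
  | succ i ih =>
    intro hi
    obtain ⟨c, rfl⟩ := ih (by omega)
    have hc : p ∣ c := h.dvd_of_pow_dvd_mul_pow hp (i := i + 1) (by omega) hj
      (by convert ha using 1; ring)
    rw [pow_succ]
    exact mul_dvd_mul_left _ hc

end IsUniserialOfLength

end Ring

/-! ### Indecomposable objects and additive functors -/

section Category

variable {C : Type*} [Category C] [Preadditive C] [HasBinaryBiproducts C]

/-- A nonzero object whose only idempotent endomorphisms are `0` and `1` is indecomposable. -/
theorem indecomposable_of_idempotents {X : C} (h0 : ¬ IsZero X)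
    (h : ∀ e : X ⟶ X, e ≫ e = e → e = 0 ∨ e = 𝟙 X) : Indecomposable X := by
  refine ⟨h0, fun Y Z i => ?_⟩
  -- The idempotent is the projection onto `Y`: its vanishing forces `Y = 0`, and its being the
  -- identity forces `Z = 0`.
  have key := h (i.hom ≫ biprod.fst ≫ biprod.inl ≫ i.inv) (by simp)
  have hconj : ∀ f, i.hom ≫ biprod.fst ≫ biprod.inl ≫ i.inv = f →
      biprod.fst ≫ (biprod.inl : Y ⟶ Y ⊞ Z) = i.inv ≫ f ≫ i.hom := by
    rintro f rfl; simp
  rcases key with hk | hk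
  · left
    rw [IsZero.iff_id_eq_zero]
    have := hconj _ hk
    simpa using congrArg (fun f => biprod.inl ≫ f ≫ biprod.fst) this
  · right
    rw [IsZero.iff_id_eq_zero]
    have := hconj _ hk
    simpa using (congrArg (fun f => biprod.inr ≫ f ≫ biprod.snd) this).symm

/-- An additive functor which reflects zero objects reflects indecomposability. -/
theorem indecomposable_of_map {D : Type*} [Category D] [Preadditive D] [HasBinaryBiproducts D]
    (G : C ⥤ D) [G.Additive] (hG : ∀ X, IsZero (G.obj X) → IsZero X) {X : C}
    (h : Indecomposable (G.obj X)) : Indecomposable X := by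
  refine ⟨fun h0 => h.1 (G.map_isZero h0), fun Y Z i => ?_⟩
  have : PreservesBinaryBiproducts G := preservesBinaryBiproducts_of_preservesBiproducts G
  exact (h.2 _ _ (G.mapIso i ≪≫ G.mapBiprod Y Z)).imp (hG Y) (hG Z)

theorem indecomposable_of_iso {X Y : C} (i : X ≅ Y) (h : Indecomposable Y) : Indecomposable X :=
  ⟨fun h0 => h.1 (h0.of_iso i.symm), fun A B j => h.2 A B (i.symm ≪≫ j)⟩

end Category

/-! ### Morphisms of representations, indecomposability and recognition -/

namespace Rep

variable {k : Type u} [Field k] {n : ℕ}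

/-- A linear map which preserves the subspaces, as a morphism. -/
def ofLinear {V W : Rep k n} (f : V.V →ₗ[k] W.V) (hf : ∀ i, ∀ v ∈ V.sub i, f v ∈ W.sub i) :
    V ⟶ W := ⟨f, hf⟩

/-- The linear map underlying a morphism. -/
def toLinear {V W : Rep k n} (f : V ⟶ W) : V.V →ₗ[k] W.V := Subtype.val f

theorem toLinear_mem {V W : Rep k n} (f : V ⟶ W) (i : Poset n) {v : V.V} (hv : v ∈ V.sub i) :
    toLinear f v ∈ W.sub i := Subtype.property f i v hv

@[ext]
theorem hom_ext {V W : Rep k n} {f g : V ⟶ W} (h : ∀ v, toLinear f v = toLinear g v) : f = g :=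
  Subtype.ext (LinearMap.ext h)

@[simp]
theorem toLinear_ofLinear {V W : Rep k n} (f : V.V →ₗ[k] W.V) (hf) :
    toLinear (ofLinear (V := V) (W := W) f hf) = f := rfl

@[simp]
theorem toLinear_id (V : Rep k n) (v : V.V) : toLinear (𝟙 V) v = v := rfl

@[simp]
theorem toLinear_comp {U V W : Rep k n} (f : U ⟶ V) (g : V ⟶ W) (v : U.V) :
    toLinear (f ≫ g) v = toLinear g (toLinear f v) := rfl

@[simp]
theorem toLinear_zero {V W : Rep k n} (v : V.V) : toLinear (0 : V ⟶ W) v = 0 := rfl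

theorem isZero_iff {V : Rep k n} : IsZero V ↔ Subsingleton V.V := by
  rw [IsZero.iff_id_eq_zero]
  constructor
  · intro h
    refine subsingleton_of_forall_eq 0 fun v => ?_
    rw [← toLinear_id V v, h, toLinear_zero]
  · intro h
    ext v
    exact Subsingleton.elim _ _

/-- A linear equivalence which identifies the subspaces is an isomorphism. -/
def isoOfEquiv {V W : Rep k n} (e : V.V ≃ₗ[k] W.V) (h : ∀ i v, v ∈ V.sub i ↔ e v ∈ W.sub i) :
    V ≅ W where
  hom := ofLinear e.toLinearMap fun i v hv => (h i v).mp hv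
  inv := ofLinear e.symm.toLinearMap fun i v hv => (h i _).mpr (by simpa using hv)
  hom_inv_id := by ext v; simp
  inv_hom_id := by ext v; simp

/-- An isomorphism and its inverse both restrict to injections of the subspaces. These dimensions
are the invariants that distinguish the listed representations. -/
theorem finrank_sub_eq {V W : Rep k n} (f : V ≅ W) (i : Poset n) :
    Module.finrank k (V.sub i) = Module.finrank k (W.sub i) := by
  have key : ∀ {V W : Rep k n} (f : V ≅ W),
      Module.finrank k (V.sub i) ≤ Module.finrank k (W.sub i) := by
    intro V W f
    refine LinearMap.finrank_le_finrank_of_injective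
      (f := (toLinear f.hom).restrict fun v hv => toLinear_mem f.hom i hv) ?_
    intro x y hxy
    have h1 := congrArg (fun z => toLinear f.inv (Subtype.val z)) hxy
    simp only [LinearMap.coe_restrict_apply, ← toLinear_comp, f.hom_inv_id, toLinear_id] at h1
    exact Subtype.ext h1
  exact le_antisymm (key f) (key f.symm)

theorem finrank_eq {V W : Rep k n} (f : V ≅ W) :
    Module.finrank k V.V = Module.finrank k W.V := by
  refine LinearEquiv.finrank_eq (LinearEquiv.ofLinearMap (toLinear f.hom) (toLinear f.inv) ?_ ?_)
  · ext v
    change toLinear (f.inv ≫ f.hom) v = v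
    simp
  · ext v
    change toLinear (f.hom ≫ f.inv) v = v
    simp

theorem indecomposable_of_scalar {V : Rep k n} (hV : Nontrivial V.V)
    (h : ∀ e : V ⟶ V, ∃ c : k, ∀ v, toLinear e v = c • v) : Indecomposable V := by
  refine indecomposable_of_idempotents
    (fun h0 => not_subsingleton V.V (isZero_iff.mp h0)) fun e he => ?_
  obtain ⟨c, hc⟩ := h e
  obtain ⟨v, hv⟩ := exists_ne (0 : V.V)
  have h1 : toLinear (e ≫ e) v = toLinear e v := by rw [he]
  rw [toLinear_comp, hc, hc, smul_smul] at h1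
  rcases IsIdempotentElem.iff_eq_zero_or_one.mp (smul_left_injective k hv h1) with h2 | h2
  · exact Or.inl (hom_ext fun w => by rw [hc, h2, zero_smul, toLinear_zero])
  · exact Or.inr (hom_ext fun w => by rw [hc, h2, one_smul, toLinear_id])

theorem indecomposable_repV (ℓ : ℕ) (a b : Fin 2) : Indecomposable (repV k n ℓ a b) := by
  refine indecomposable_of_scalar (inferInstanceAs (Nontrivial k)) fun e => ?_
  let f : k →ₗ[k] k := toLinear e
  refine ⟨f 1, fun v : k => ?_⟩
  change f v = f 1 * v
  rw [mul_comm, ← smul_eq_mul, ← map_smul, smul_eq_mul, mul_one]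

/-- An endomorphism preserves the three distinct lines `V'`, `V''` and `V^t = k(1,1)` of a plane, so
it is a scalar. The bounds `s < t < n` ensure that the diagonal occurs in the chain. -/
theorem indecomposable_repW {s t : ℕ} (hst : s < t) (ht : t < n) :
    Indecomposable (repW k n s t) := by
  refine indecomposable_of_scalar (inferInstanceAs (Nontrivial (k × k))) fun e => ?_
  let f : k × k →ₗ[k] k × k := toLinear e
  have h1 : (f (1, 0)).2 = 0 :=
    (toLinear_mem e (.prime) (v := ((1, 0) : k × k)) ⟨trivial, rfl⟩).2
  have h2 : (f (0, 1)).1 = 0 :=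
    (toLinear_mem e (.dprime) (v := ((0, 1) : k × k)) ⟨rfl, trivial⟩).1
  have h3 : f (1, 1) ∈ Submodule.span k {((1, 1) : k × k)} := by
    have hsub : (repW k n s t).sub (.chain t (by omega) ht) =
        (Submodule.span k {((1, 1) : k × k)} : Submodule k (k × k)) :=
      (if_neg (by omega)).trans (if_pos le_rfl)
    have hmem : ∀ x : k × k, (x : (repW k n s t).V) ∈ (repW k n s t).sub
        (.chain t (by omega) ht) ↔ x ∈ Submodule.span k {((1, 1) : k × k)} := fun x =>
      iff_of_eq (congrArg (fun N : Submodule k (k × k) => x ∈ N) hsub)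
    exact (hmem _).mp (toLinear_mem e _ ((hmem _).mpr (Submodule.mem_span_singleton_self _)))
  obtain ⟨c, hc⟩ := Submodule.mem_span_singleton.mp h3
  refine ⟨c, fun (v : k × k) => ?_⟩
  have hsum : f (1, 1) = f (1, 0) + f (0, 1) := by rw [← map_add]; simp
  have hv : v = v.1 • ((1, 0) : k × k) + v.2 • ((0, 1) : k × k) := by ext <;> simp
  change f v = c • v
  rw [← hc] at hsum
  have e1 := congrArg Prod.fst hsum
  have e2 := congrArg Prod.snd hsum
  simp only [Prod.smul_fst, Prod.smul_snd, Prod.fst_add, Prod.snd_add, h1, h2, smul_eq_mul,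
    mul_one, add_zero, zero_add] at e1 e2
  rw [hv, map_add, map_smul, map_smul]
  ext
  · simp [h2, ← e1, mul_comm]
  · simp [h1, ← e2, mul_comm]

/-- Recognition of the representations `V_{ℓ,ℓ',ℓ''}`. -/
theorem nonempty_iso_repV {V : Rep k n} {ℓ : ℕ} {a b : Fin 2} (v : V.V) (hv : v ≠ 0)
    (hspan : ∀ x, ∃ c : k, c • v = x)
    (hchain : ∀ i h1 h2, v ∈ V.sub (.chain i h1 h2) ↔ i ≤ ℓ)
    (hprime : v ∈ V.sub .prime ↔ a = 1) (hdprime : v ∈ V.sub .dprime ↔ b = 1) :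
    Nonempty (V ≅ repV k n ℓ a b) := by
  have hinj : Function.Injective (LinearMap.toSpanSingleton k V.V v) := smul_left_injective k hv
  let e : k ≃ₗ[k] V.V := LinearEquiv.ofBijective (LinearMap.toSpanSingleton k V.V v) ⟨hinj, hspan⟩
  refine ⟨(isoOfEquiv (V := repV k n ℓ a b) e ?_).symm⟩
  -- On a line, a subspace is everything or zero according to whether it contains `v`; this treats
  -- all points of the poset alike.
  have key : ∀ (P : Prop) [Decidable P] (i : Poset n), (v ∈ V.sub i ↔ P) → ∀ c : k,
      c ∈ (if P then ⊤ else ⊥ : Submodule k k) ↔ c • v ∈ V.sub i := by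
    intro P _ i h c
    split_ifs with hP
    · simpa using (V.sub i).smul_mem c (h.mpr hP)
    · rw [Submodule.mem_bot]
      refine ⟨fun hc => by simp [hc], fun hc => ?_⟩
      by_contra h0
      exact hP (h.mp (((V.sub i).smul_mem_iff h0).mp hc))
  rintro (⟨i, h1, h2⟩ | _ | _) c
  · exact key _ _ (hchain i h1 h2) c
  · exact key _ _ hprime c
  · exact key _ _ hdprime c

/-- Recognition of the representations `W_{s,t}`. -/
theorem nonempty_iso_repW {V : Rep k n} {s t : ℕ} (v w : V.V)
    (hspan : ∀ x, ∃ c d : k, c • v + d • w = x)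
    (hind : ∀ c d : k, c • v + d • w = 0 → c = 0 ∧ d = 0)
    (hchain : ∀ i h1 h2, ∀ c d : k, c • v + d • w ∈ V.sub (.chain i h1 h2) ↔
      (i ≤ s ∨ c = d) ∧ (i ≤ t ∨ (c = 0 ∧ d = 0)))
    (hst : s ≤ t)
    (hprime : ∀ c d : k, c • v + d • w ∈ V.sub .prime ↔ d = 0)
    (hdprime : ∀ c d : k, c • v + d • w ∈ V.sub .dprime ↔ c = 0) :
    Nonempty (V ≅ repW k n s t) := by
  let f : k × k →ₗ[k] V.V :=
    (LinearMap.toSpanSingleton k V.V v).coprod (LinearMap.toSpanSingleton k V.V w)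
  have hf : ∀ x, f x = x.1 • v + x.2 • w := fun _ => rfl
  have hinj : Function.Injective f := by
    rw [injective_iff_map_eq_zero]
    rintro ⟨c, d⟩ h
    obtain ⟨rfl, rfl⟩ := hind c d h
    rfl
  let e : (k × k) ≃ₗ[k] V.V := LinearEquiv.ofBijective f ⟨hinj, fun x => by
    obtain ⟨c, d, h⟩ := hspan x
    exact ⟨(c, d), h⟩⟩
  refine ⟨(isoOfEquiv (V := repW k n s t) e ?_).symm⟩
  rintro (⟨i, h1, h2⟩ | _ | _) ⟨c, d⟩
  · refine Iff.trans ?_ (hchain i h1 h2 c d).symm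
    change (c, d) ∈ (if i ≤ s then ⊤ else if i ≤ t then Submodule.span k {((1, 1) : k × k)} else ⊥)
      ↔ _
    split_ifs with hs ht
    · simp [hs, hs.trans hst]
    · simp [hs, ht, Submodule.mem_span_singleton]
    · simp only [Submodule.mem_bot, hs, ht, false_or, Prod.mk_eq_zero]
      exact ⟨fun h => ⟨h.1.trans h.2.symm, h⟩, fun h => h.2⟩
  · refine Iff.trans ?_ (hprime c d).symm
    change (c, d) ∈ Submodule.prod ⊤ ⊥ ↔ _
    simp
  · refine Iff.trans ?_ (hdprime c d).symm
    change (c, d) ∈ Submodule.prod ⊥ ⊤ ↔ _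
    simp

/-! ### Splitting off direct summands -/

/-- The restriction of a representation to a subspace. -/
def restrict (V : Rep k n) (H : Submodule k V.V) : Rep k n where
  V := H
  sub := ⟨fun i => (V.sub i).comap H.subtype, fun _ _ h => Submodule.comap_mono (V.sub.monotone h)⟩

theorem level_restrict (V : Rep k n) (H : Submodule k V.V) (i : ℕ) :
    (V.restrict H).level i = (V.level i).comap H.subtype := by
  unfold level
  split_ifs
  · rfl
  · rfl

section Split

variable {V S : Rep k n} (ι : S ⟶ V) (π : V ⟶ S) (h : ι ≫ π = 𝟙 S)

include h

theorem toLinear_section (x : S.V) : toLinear π (toLinear ι x) = x := by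
  rw [← toLinear_comp, h, toLinear_id]

theorem sub_section_mem_ker (v : V.V) :
    v - toLinear ι (toLinear π v) ∈ LinearMap.ker (toLinear π) := by
  rw [LinearMap.mem_ker, map_sub, toLinear_section ι π h, sub_self]

/-- A split epimorphism of representations decomposes its source. -/
theorem nonempty_iso_biprod_of_section :
    Nonempty (V ≅ S ⊞ V.restrict (LinearMap.ker (toLinear π))) := by
  let H := LinearMap.ker (toLinear π)
  let q : V ⟶ V.restrict H := ofLinear
    ((LinearMap.id - (toLinear ι).comp (toLinear π)).codRestrict H
      fun v => sub_section_mem_ker ι π h v)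
    fun i v hv => (V.sub i).sub_mem hv (toLinear_mem ι i (toLinear_mem π i hv))
  let j : V.restrict H ⟶ V := ofLinear H.subtype fun i v hv => hv
  let b : BinaryBicone S (V.restrict H) :=
    { pt := V
      fst := π
      snd := q
      inl := ι
      inr := j
      inl_fst := h
      inl_snd := by
        ext x
        refine Subtype.ext ?_
        change toLinear ι x - toLinear ι (toLinear π (toLinear ι x)) = 0
        rw [toLinear_section ι π h, sub_self]
      inr_fst := by
        ext x
        exact LinearMap.mem_ker.mp x.2
      inr_snd := by
        ext (x : H)
        refine Subtype.ext ?_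
        change (x : V.V) - toLinear ι (toLinear π (x : V.V)) = x
        rw [LinearMap.mem_ker.mp x.2, map_zero, sub_zero] }
  refine ⟨biprod.uniqueUpToIso _ _ (b := b) (isBinaryBilimitOfTotal b ?_)⟩
  ext v
  change toLinear ι (toLinear π v) + (v - toLinear ι (toLinear π v)) = v
  abel

/-- The projection `1 - ιπ` onto the kernel preserves all subspaces, so it turns a decomposition in
`V' + V''` of a vector of the kernel into one inside the kernel. -/
theorem restricted_restrict_ker (hV : restricted k n V) :
    restricted k n (V.restrict (LinearMap.ker (toLinear π))) := by
  constructor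
  · rw [level_restrict]
    exact Submodule.comap_mono hV.1
  · rw [eq_top_iff]
    rintro ⟨v, hv⟩ -
    have hv2 : v ∈ V.sub .prime ⊔ V.sub .dprime := by rw [hV.2]; trivial
    obtain ⟨a, ha, b, hb, rfl⟩ := Submodule.mem_sup.mp hv2
    refine Submodule.mem_sup.mpr ⟨⟨_, sub_section_mem_ker ι π h a⟩,
      (V.sub _).sub_mem ha (toLinear_mem ι _ (toLinear_mem π _ ha)),
      ⟨_, sub_section_mem_ker ι π h b⟩,
      (V.sub _).sub_mem hb (toLinear_mem ι _ (toLinear_mem π _ hb)), Subtype.ext ?_⟩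
    have h0 : toLinear ι (toLinear π a) + toLinear ι (toLinear π b) = 0 := by
      rw [← map_add, ← map_add, LinearMap.mem_ker.mp hv, map_zero]
    change a - toLinear ι (toLinear π a) + (b - toLinear ι (toLinear π b)) = a + b
    rw [sub_add_sub_comm, h0, sub_zero]

theorem finrank_restrict_ker_lt (hS : Nontrivial S.V) :
    Module.finrank k (V.restrict (LinearMap.ker (toLinear π))).V < Module.finrank k V.V := by
  refine Submodule.finrank_lt fun htop => ?_
  obtain ⟨x, hx⟩ := exists_ne (0 : S.V)
  apply hx
  rw [← toLinear_section ι π h x]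
  exact LinearMap.mem_ker.mp (htop ▸ Submodule.mem_top)

end Split

end Rep

/-! ### Computing in `A⁺ / A⁻`, and reflection of zero objects -/

section Functor

variable {Λ : Type u} [CommRing Λ] [IsLocalRing Λ] {n : ℕ}

namespace SubPair

theorem minus_le (X : SubPair Λ 2) : X.minus ≤ X.A :=
  Submodule.smul_le.mpr fun r _ _ ha => X.A.smul_mem r ha

theorem minus_le_plus (X : SubPair Λ 2) : X.minus ≤ X.plus := X.minus_le.trans le_sup_left

theorem isZero_iff {m : ℕ} {X : SubPair Λ m} : IsZero X ↔ Subsingleton X.B := by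
  rw [IsZero.iff_id_eq_zero]
  constructor
  · intro h
    refine subsingleton_of_forall_eq 0 fun b => ?_
    exact congrArg (fun f : homs X X => f.1 b) h
  · intro h
    exact Subtype.ext (LinearMap.ext fun b => Subsingleton.elim _ _)

/-- The class in `A⁺ / A⁻` of an element of `A⁺`. -/
def toTotal (X : SubPair Λ 2) (x : X.B) (hx : x ∈ X.plus) : X.Total :=
  Submodule.Quotient.mk ⟨x, hx⟩

theorem toTotal_eq_iff (X : SubPair Λ 2) {x y : X.B} (hx : x ∈ X.plus) (hy : y ∈ X.plus) :
    X.toTotal x hx = X.toTotal y hy ↔ x - y ∈ X.minus :=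
  Submodule.Quotient.eq _

theorem toTotal_eq_zero_iff (X : SubPair Λ 2) {x : X.B} (hx : x ∈ X.plus) :
    X.toTotal x hx = 0 ↔ x ∈ X.minus :=
  Submodule.Quotient.mk_eq_zero _

theorem residue_smul_toTotal (X : SubPair Λ 2) (c : Λ) {x : X.B} (hx : x ∈ X.plus) :
    residue Λ c • X.toTotal x hx = X.toTotal (c • x) (X.plus.smul_mem c hx) :=
  algebraMap_smul (ResidueField Λ) c (X.toTotal x hx)

/-- The intersection with `A⁺` in the definition of `tilde` is harmless: as `A⁻ ⊆ A⁺`, the `C`-part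
of an element of `A⁺ ∩ (C + A⁻)` lies in `A⁺` again. -/
theorem toTotal_mem_tilde_iff (X : SubPair Λ 2) (C : Submodule Λ X.B) {x : X.B}
    (hx : x ∈ X.plus) : X.toTotal x hx ∈ X.tilde C ↔ x ∈ C ⊔ X.minus := by
  constructor
  · rintro ⟨y, hy, hyx⟩
    have h1 := (X.toTotal_eq_iff y.2 hx).mp hyx
    exact Submodule.mem_sup.mpr ⟨y, hy, -(y - x), X.minus.neg_mem h1, by abel⟩
  · intro h
    obtain ⟨c, hc, m, hm, rfl⟩ := Submodule.mem_sup.mp h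
    have hcp : c ∈ X.plus := by
      have := X.plus.sub_mem hx (X.minus_le_plus hm)
      rwa [add_sub_cancel_right] at this
    refine ⟨⟨c, hcp⟩, hc, (X.toTotal_eq_iff hcp hx).mpr ?_⟩
    simpa using X.minus.neg_mem hm

section Membership

variable {B : Type u} [AddCommGroup B] [Module Λ B] {p : Λ} (hp : maximalIdeal Λ = Ideal.span {p})

include hp

theorem mem_soc_iff {x : B} : x ∈ soc Λ B ↔ p • x = 0 := by
  rw [Submodule.mem_torsionBySet_iff]
  constructor
  · intro h
    exact h ⟨p, by rw [SetLike.mem_coe, hp]; exact Ideal.mem_span_singleton_self p⟩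
  · rintro h ⟨r, hr⟩
    rw [SetLike.mem_coe, hp, Ideal.mem_span_singleton] at hr
    obtain ⟨c, rfl⟩ := hr
    change (p * c) • x = 0
    rw [mul_comm, mul_smul, h, smul_zero]

theorem mem_maximalIdeal_pow_smul_iff {N : Submodule Λ B} {i : ℕ} {x : B} :
    x ∈ maximalIdeal Λ ^ i • N ↔ ∃ y ∈ N, p ^ i • y = x := by
  rw [hp, Ideal.span_singleton_pow, Submodule.ideal_span_singleton_smul,
    Submodule.mem_smul_pointwise_iff_exists]

theorem mem_radPow_iff {i : ℕ} {x : B} : x ∈ radPow Λ B i ↔ ∃ y, p ^ i • y = x := by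
  simp [mem_maximalIdeal_pow_smul_iff hp]

theorem mem_minus_iff {X : SubPair Λ 2} {x : X.B} : x ∈ X.minus ↔ ∃ y ∈ X.A, p • y = x := by
  have := mem_maximalIdeal_pow_smul_iff hp (N := X.A) (i := 1) (x := x)
  rwa [pow_one, pow_one] at this

end Membership

/-- If `𝔪 ^ (j+1) B = 0`, then `𝔪 ^ j B` lies in the socle and vanishes; descend from `𝔪 ^ n = 0` to
`B` itself. -/
theorem subsingleton_of_soc_eq_bot (hΛ : IsUniserialOfLength Λ n) {B : Type u} [AddCommGroup B]
    [Module Λ B] (h : soc Λ B = ⊥) : Subsingleton B := by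
  have key : ∀ j, maximalIdeal Λ ^ j • (⊤ : Submodule Λ B) = ⊥ →
      (⊤ : Submodule Λ B) = ⊥ := by
    intro j
    induction j with
    | zero => intro hj; simpa using hj
    | succ j ih =>
      intro hj
      apply ih
      rw [eq_bot_iff, ← h]
      intro x hx
      rw [Submodule.mem_torsionBySet_iff]
      rintro ⟨r, hr⟩
      have : r • x ∈ maximalIdeal Λ ^ (j + 1) • (⊤ : Submodule Λ B) := by
        rw [pow_succ', mul_smul]
        exact Submodule.smul_mem_smul hr hx
      rwa [hj] at this
  have := key n (by rw [hΛ.pow_eq_bot, Submodule.bot_smul])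
  exact (Submodule.subsingleton_iff Λ).mp (subsingleton_of_bot_eq_top this.symm)

theorem isZero_of_subsingleton_total (hΛ : IsUniserialOfLength Λ n) {X : SubPair Λ 2}
    (h : Subsingleton X.Total) : IsZero X := by
  have h1 : X.plus ≤ X.minus := fun x hx =>
    (X.toTotal_eq_zero_iff hx).mp (Subsingleton.elim _ _)
  have hA : X.A = ⊥ := by
    have h2 : maximalIdeal Λ • X.A = X.A :=
      le_antisymm X.minus_le (le_sup_left.trans h1)
    rw [← X.bounded, pow_two, mul_smul, h2, h2]
  have h3 : soc Λ X.B = ⊥ := by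
    rw [eq_bot_iff, ← hA]
    exact le_sup_right.trans (h1.trans X.minus_le)
  exact isZero_iff.mpr (subsingleton_of_soc_eq_bot hΛ h3)

end SubPair

instance (hΛ : IsUniserialOfLength Λ n) : (F hΛ).Additive where
  map_add {X Y f g} := Subtype.ext <| LinearMap.ext fun x => by
    obtain ⟨x, rfl⟩ := Submodule.Quotient.mk_surjective _ x
    rfl

theorem isZero_of_F_obj (hΛ : IsUniserialOfLength Λ n) (X : SubPair Λ 2)
    (h : IsZero ((F hΛ).obj X)) : IsZero X :=
  SubPair.isZero_of_subsingleton_total hΛ (Rep.isZero_iff.mp h)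

/-! ### The values of the functor on pickets -/

/-- The submodule generated by `p ^ j` of `Λ / (p ^ ℓ)`. -/
def quotPow (p : Λ) (ℓ j : ℕ) : Submodule Λ (Λ ⧸ Ideal.span {p ^ ℓ}) :=
  Submodule.span Λ {Ideal.Quotient.mk (Ideal.span {p ^ ℓ}) (p ^ j)}

variable {p : Λ} {ℓ : ℕ}

omit [IsLocalRing Λ] in
-- The minimum appears because `p ^ ℓ` is zero in the quotient, so that exponents beyond `ℓ` all
-- give the zero submodule.
theorem mk_mem_quotPow_iff {j : ℕ} {y : Λ} :
    Ideal.Quotient.mk (Ideal.span {p ^ ℓ}) y ∈ quotPow p ℓ j ↔ p ^ min j ℓ ∣ y := by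
  rw [quotPow, Submodule.mem_span_singleton]
  constructor
  · rintro ⟨c, hc⟩
    change Ideal.Quotient.mk _ (c * p ^ j) = _ at hc
    rw [Ideal.Quotient.eq, Ideal.mem_span_singleton] at hc
    have h1 := (pow_dvd_pow p (min_le_right j ℓ)).trans hc
    exact (dvd_sub_right ((pow_dvd_pow p (min_le_left j ℓ)).mul_left c)).mp h1
  · rintro ⟨c, rfl⟩
    rcases le_total j ℓ with h | h
    · rw [min_eq_left h]
      exact ⟨c, congrArg (Ideal.Quotient.mk _) (mul_comm c (p ^ j))⟩
    · rw [min_eq_right h]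
      refine ⟨0, ?_⟩
      rw [zero_smul, eq_comm, Ideal.Quotient.eq_zero_iff_mem, Ideal.mem_span_singleton]
      exact dvd_mul_right _ _

omit [IsLocalRing Λ] in
theorem smul_mk_eq_zero_iff {y c : Λ} :
    c • Ideal.Quotient.mk (Ideal.span {p ^ ℓ}) y = 0 ↔ p ^ ℓ ∣ c * y := by
  change Ideal.Quotient.mk _ (c * y) = 0 ↔ _
  rw [Ideal.Quotient.eq_zero_iff_mem, Ideal.mem_span_singleton]

omit [IsLocalRing Λ] in
theorem quotPow_antitone : Antitone (quotPow p ℓ) := fun i j h => by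
  rw [quotPow, Submodule.span_le, Set.singleton_subset_iff, SetLike.mem_coe, mk_mem_quotPow_iff]
  exact pow_dvd_pow p ((min_le_left i ℓ).trans h)

omit [IsLocalRing Λ] in
theorem quotPow_sup (i j : ℕ) : quotPow p ℓ i ⊔ quotPow p ℓ j = quotPow p ℓ (min i j) := by
  rcases le_total i j with h | h
  · rw [min_eq_left h, sup_eq_left.mpr (quotPow_antitone h)]
  · rw [min_eq_right h, sup_eq_right.mpr (quotPow_antitone h)]

theorem maximalIdeal_pow_smul_quotPow (hp : maximalIdeal Λ = Ideal.span {p}) (i j : ℕ) :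
    maximalIdeal Λ ^ i • quotPow p ℓ j = quotPow p ℓ (i + j) := by
  rw [hp, Ideal.span_singleton_pow, Submodule.ideal_span_singleton_smul, quotPow, quotPow,
    Submodule.smul_span, Set.smul_set_singleton, pow_add]
  rfl

theorem radPow_quotient (hp : maximalIdeal Λ = Ideal.span {p}) (i : ℕ) :
    SubPair.radPow Λ (Λ ⧸ Ideal.span {p ^ ℓ}) i = quotPow p ℓ i := by
  have htop : (⊤ : Submodule Λ (Λ ⧸ Ideal.span {p ^ ℓ})) = quotPow p ℓ 0 := by
    symm
    rw [eq_top_iff]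
    intro x _
    obtain ⟨y, rfl⟩ := Ideal.Quotient.mk_surjective x
    rw [mk_mem_quotPow_iff]
    simp
  rw [SubPair.radPow, htop, maximalIdeal_pow_smul_quotPow hp, add_zero]

theorem soc_quotient (hΛ : IsUniserialOfLength Λ n) (hp : maximalIdeal Λ = Ideal.span {p})
    (h1 : 1 ≤ ℓ) (hn : ℓ ≤ n) :
    SubPair.soc Λ (Λ ⧸ Ideal.span {p ^ ℓ}) = quotPow p ℓ (ℓ - 1) := by
  ext x
  obtain ⟨y, rfl⟩ := Ideal.Quotient.mk_surjective x
  rw [SubPair.mem_soc_iff hp, mk_mem_quotPow_iff, min_eq_left (by omega)]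
  refine smul_mk_eq_zero_iff.trans ⟨hΛ.pow_pred_dvd_of_pow_dvd_mul hp hn, fun h => ?_⟩
  have := mul_dvd_mul_left p h
  rwa [← pow_succ', Nat.sub_add_cancel h1] at this

theorem mk_pow_mem_quotPow_iff (hΛ : IsUniserialOfLength Λ n)
    (hp : maximalIdeal Λ = Ideal.span {p}) (hn : ℓ ≤ n) {q : ℕ} (hq : q < ℓ) (j : ℕ) :
    Ideal.Quotient.mk (Ideal.span {p ^ ℓ}) (p ^ q) ∈ quotPow p ℓ j ↔ j ≤ q := by
  rw [mk_mem_quotPow_iff]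
  constructor
  · intro h
    by_contra hlt
    exact hΛ.not_pow_dvd_pow hp (i := q) (j := min j ℓ) (by omega) (by omega) h
  · intro h
    exact pow_dvd_pow p ((min_le_left j ℓ).trans h)

/-- All submodules involved are generated by powers of `p`, so the three kinds of pickets are
treated at once. `A⁺` is generated by `p ^ q` and `A⁻` by `p ^ (1 + (ℓ - m))`; the class of `p ^ q`
spans `A⁺ / A⁻`, and its membership in each subspace is an inequality of exponents. -/
theorem nonempty_F_picket_iso (hΛ : IsUniserialOfLength Λ n)
    (hp : maximalIdeal Λ = Ideal.span {p}) {m : ℕ} (h1 : 1 ≤ ℓ) (hn : ℓ ≤ n) (hm : m ≤ 2)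
    {q : ℕ} (hq : q = min (ℓ - m) (ℓ - 1)) {a b : Fin 2} (ha : ℓ - 1 ≤ q ↔ a = 1)
    (hb : ℓ - m ≤ q ↔ b = 1) :
    Nonempty ((F hΛ).obj (SubPair.picket hp ℓ m hm) ≅ Rep.repV (ResidueField Λ) n q a b) := by
  let X := SubPair.picket hp ℓ m hm
  let N : ℕ → Submodule Λ X.B := quotPow p ℓ
  have hrad : ∀ i, SubPair.radPow Λ X.B i = N i := radPow_quotient hp
  have hsoc : SubPair.soc Λ X.B = N (ℓ - 1) := soc_quotient hΛ hp h1 hn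
  have hA : X.A = N (ℓ - m) := rfl
  have hminus : X.minus = N (1 + (ℓ - m)) := by
    have := maximalIdeal_pow_smul_quotPow (ℓ := ℓ) hp 1 (ℓ - m)
    rwa [pow_one] at this
  have hplus : X.plus = N q := by
    rw [SubPair.plus, hsoc, hq]
    exact quotPow_sup _ _
  let x : X.B := Ideal.Quotient.mk (Ideal.span {p ^ ℓ}) (p ^ q)
  have hmem : ∀ j, x ∈ N j ↔ j ≤ q := mk_pow_mem_quotPow_iff hΛ hp hn (by omega)
  have hx : x ∈ X.plus := by rw [hplus, hmem]
  have htilde : ∀ j, X.toTotal x hx ∈ X.tilde (N j) ↔ j ≤ q := by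
    intro j
    have hs : N j ⊔ N (1 + (ℓ - m)) = N (min j (1 + (ℓ - m))) := quotPow_sup _ _
    rw [SubPair.toTotal_mem_tilde_iff, hminus, hs, hmem]
    -- Here `q ≤ ℓ - m`, so the term `1 + (ℓ - m)` coming from `A⁻` never decides the inequality.
    omega
  refine Rep.nonempty_iso_repV (V := (F hΛ).obj X) (X.toTotal x hx) ?_ ?_ ?_ ?_ ?_
  · intro h0
    have := (X.toTotal_eq_zero_iff hx).mp h0
    rw [hminus, hmem] at this
    omega
  · intro z
    obtain ⟨⟨z, hz⟩, rfl⟩ := Submodule.Quotient.mk_surjective _ z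
    have hz2 := hz
    rw [hplus] at hz2
    obtain ⟨c, hc⟩ : ∃ c : Λ, c • x = z :=
      (Submodule.mem_span_singleton (R := Λ) (M := Λ ⧸ Ideal.span {p ^ ℓ})).mp hz2
    subst hc
    exact ⟨residue Λ c, X.residue_smul_toTotal c hx⟩
  · intro i _ _
    rw [← htilde i, ← hrad i]
    rfl
  · rw [← ha, ← htilde (ℓ - 1), ← hsoc]
    rfl
  · rw [← hb, ← htilde (ℓ - m)]
    rfl

/-! ### The values of the functor on the pairs `Q^t_s` -/

/-- Here `A⁻ = (p ^ (t-1)) ⊕ 0`. The classes `v` of `(0, -p ^ (s-1))`, which lies in the socle, and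
`w` of `(p ^ (t-2), p ^ (s-1))`, the generator of `A`, form a basis. Their sum is the class of `(p ^
(t-2), 0)`, which lies deeper in the radical filtration than either of them and gives the diagonal.
-/
theorem nonempty_F_pairQ_iso (hΛ : IsUniserialOfLength Λ n)
    (hp : maximalIdeal Λ = Ideal.span {p}) {s t : ℕ} (h1 : 1 ≤ s) (hst : s - 1 < t - 2)
    (hn : t ≤ n) :
    Nonempty ((F hΛ).obj (SubPair.pairQ hp t s) ≅
      Rep.repW (ResidueField Λ) n (s - 1) (t - 2)) := by
  let X := SubPair.pairQ hp t s
  have hts : t - 1 = t - 2 + 1 := by omega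
  have hss : s = s - 1 + 1 := by omega
  let mk (y z : Λ) : X.B :=
    (Ideal.Quotient.mk (Ideal.span {p ^ t}) y, Ideal.Quotient.mk (Ideal.span {p ^ s}) z)
  have mk_surj : ∀ x : X.B, ∃ y z, mk y z = x := by
    rintro ⟨y, z⟩
    obtain ⟨y, rfl⟩ := Ideal.Quotient.mk_surjective y
    obtain ⟨z, rfl⟩ := Ideal.Quotient.mk_surjective z
    exact ⟨y, z, rfl⟩
  have mk_eq : ∀ {y z y' z'}, mk y z = mk y' z' ↔ p ^ t ∣ y - y' ∧ p ^ s ∣ z - z' := by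
    intro y z y' z'
    refine (Prod.mk_inj).trans ?_
    rw [Ideal.Quotient.eq, Ideal.Quotient.eq, Ideal.mem_span_singleton, Ideal.mem_span_singleton]
  have mk_zero : mk 0 0 = 0 := rfl
  have smul_mk : ∀ c y z, c • mk y z = mk (c * y) (c * z) := fun _ _ _ => rfl
  have add_mk : ∀ y z y' z', mk y z + mk y' z' = mk (y + y') (z + z') := fun _ _ _ _ => rfl
  have sub_mk : ∀ y z y' z', mk y z - mk y' z' = mk (y - y') (z - z') := fun _ _ _ _ => rfl
  have memA : ∀ {x}, x ∈ X.A ↔ ∃ c, mk (c * p ^ (t - 2)) (c * p ^ (s - 1)) = x :=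
    Submodule.mem_span_singleton (R := Λ)
      (M := (Λ ⧸ Ideal.span {p ^ t}) × (Λ ⧸ Ideal.span {p ^ s}))
  have mem_minus : ∀ {y z}, mk y z ∈ X.minus ↔ p ^ (t - 1) ∣ y ∧ p ^ s ∣ z := by
    intro y z
    rw [SubPair.mem_minus_iff hp]
    constructor
    · rintro ⟨_, hx, h⟩
      obtain ⟨c, rfl⟩ := memA.mp hx
      rw [smul_mk, mk_eq] at h
      constructor
      · refine (dvd_sub_right ?_).mp ((pow_dvd_pow p (by omega)).trans h.1)
        exact ⟨c, by rw [hts]; ring⟩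
      · refine (dvd_sub_right ?_).mp h.2
        exact ⟨c, by conv_rhs => rw [hss]
                     ring⟩
    · rintro ⟨⟨c, rfl⟩, hz⟩
      refine ⟨_, memA.mpr ⟨c, rfl⟩, ?_⟩
      rw [smul_mk, mk_eq]
      constructor
      · rw [hts]; ring_nf; simp
      · refine dvd_sub ⟨c, ?_⟩ hz
        conv_rhs => rw [hss]
        ring
  have mem_soc : ∀ {y z}, mk y z ∈ SubPair.soc Λ X.B ↔ p ^ (t - 1) ∣ y ∧ p ^ (s - 1) ∣ z := by
    intro y z
    rw [SubPair.mem_soc_iff hp, smul_mk, ← mk_zero, mk_eq, sub_zero, sub_zero]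
    constructor
    · rintro ⟨hy, hz⟩
      exact ⟨hΛ.pow_pred_dvd_of_pow_dvd_mul hp hn hy,
        hΛ.pow_pred_dvd_of_pow_dvd_mul hp (by omega) hz⟩
    · rintro ⟨hy, hz⟩
      have ht : t = t - 1 + 1 := by omega
      constructor
      · rw [ht, pow_succ']; exact mul_dvd_mul_left p hy
      · rw [hss, pow_succ']; exact mul_dvd_mul_left p hz
  have minus_le_soc : X.minus ≤ SubPair.soc Λ X.B := by
    intro x hx
    obtain ⟨y, z, rfl⟩ := mk_surj x
    obtain ⟨hy, hz⟩ := mem_minus.mp hx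
    exact mem_soc.mpr ⟨hy, (pow_dvd_pow p (by omega)).trans hz⟩
  have mem_rad : ∀ {i y z}, i ≤ t → (mk y z ∈ SubPair.radPow Λ X.B i ↔
      p ^ i ∣ y ∧ p ^ min i s ∣ z) := by
    intro i y z hi
    rw [SubPair.mem_radPow_iff hp]
    constructor
    · rintro ⟨x, hx⟩
      obtain ⟨y', z', rfl⟩ := mk_surj x
      rw [smul_mk, mk_eq] at hx
      exact ⟨(dvd_sub_right (dvd_mul_right _ _)).mp ((pow_dvd_pow p hi).trans hx.1),
        (dvd_sub_right ((pow_dvd_pow p (min_le_left i s)).mul_right _)).mp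
          ((pow_dvd_pow p (min_le_right i s)).trans hx.2)⟩
    · rintro ⟨⟨y', rfl⟩, hz⟩
      rcases le_total i s with h | h
      · rw [min_eq_left h] at hz
        obtain ⟨z', rfl⟩ := hz
        exact ⟨mk y' z', rfl⟩
      · rw [min_eq_right h] at hz
        refine ⟨mk y' 0, ?_⟩
        rw [smul_mk, mk_eq]
        simpa using hz
  have minus_le_rad : ∀ {i}, i ≤ t - 1 → X.minus ≤ SubPair.radPow Λ X.B i := by
    intro i hi x hx
    obtain ⟨y, z, rfl⟩ := mk_surj x
    obtain ⟨hy, hz⟩ := mem_minus.mp hx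
    exact (mem_rad (by omega)).mpr ⟨(pow_dvd_pow p hi).trans hy,
      (pow_dvd_pow p (min_le_right i s)).trans hz⟩
  have pdvd : ∀ {c : Λ}, residue Λ c = 0 ↔ p ∣ c := by
    intro c
    rw [residue_eq_zero_iff, hp, Ideal.mem_span_singleton]
  have dvd_t : ∀ {c : Λ} {i : ℕ}, i = t - 2 + 1 → (p ^ i ∣ c * p ^ (t - 2) ↔ p ∣ c) := by
    rintro c _ rfl
    refine ⟨hΛ.dvd_of_pow_dvd_mul_pow hp (by omega) (by omega), fun h => ?_⟩
    rw [pow_succ']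
    exact mul_dvd_mul_right h _
  have dvd_s : ∀ {c : Λ}, p ^ s ∣ c * p ^ (s - 1) ↔ p ∣ c := by
    intro c
    refine ⟨hΛ.dvd_of_pow_dvd_mul_pow hp (by omega) (by omega), fun h => ?_⟩
    conv_lhs => rw [hss, pow_succ']
    exact mul_dvd_mul_right h _
  -- A representative of `c v + d w`.
  let el (c d : Λ) : X.B := mk (d * p ^ (t - 2)) ((d - c) * p ^ (s - 1))
  have el_plus : ∀ c d, el c d ∈ X.plus := fun c d => Submodule.mem_sup.mpr
    ⟨_, memA.mpr ⟨d, rfl⟩, mk 0 (-c * p ^ (s - 1)),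
      mem_soc.mpr ⟨dvd_zero _, dvd_mul_left _ _⟩, by
        rw [add_mk]
        change mk _ _ = mk _ _
        congr 1 <;> ring⟩
  have el_minus : ∀ {c d}, el c d ∈ X.minus ↔ p ∣ d ∧ p ∣ d - c := by
    intro c d
    rw [mem_minus, dvd_t hts, dvd_s]
  let v : X.Total := X.toTotal (el 1 0) (el_plus 1 0)
  let w : X.Total := X.toTotal (el 0 1) (el_plus 0 1)
  have comb : ∀ c d : Λ, residue Λ c • v + residue Λ d • w = X.toTotal (el c d) (el_plus c d) := by
    intro c d
    rw [SubPair.residue_smul_toTotal, SubPair.residue_smul_toTotal]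
    refine (X.toTotal_eq_iff (X.plus.add_mem (X.plus.smul_mem c (el_plus 1 0))
      (X.plus.smul_mem d (el_plus 0 1))) (el_plus c d)).mpr ?_
    rw [smul_mk, smul_mk, add_mk, sub_mk]
    refine mem_minus.mpr ⟨?_, ?_⟩ <;> ring_nf <;> simp
  have hmem : ∀ (C : Submodule Λ X.B) (c d : Λ),
      residue Λ c • v + residue Λ d • w ∈ X.tilde C ↔ el c d ∈ C ⊔ X.minus := by
    intro C c d
    rw [comb, SubPair.toTotal_mem_tilde_iff]
  -- Statements about coefficients in `k` are checked on lifts to `Λ`, where they become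
  -- divisibilities by `p`.
  have hrep : ∀ {P : ResidueField Λ → ResidueField Λ → Prop},
      (∀ c d, P (residue Λ c) (residue Λ d)) → ∀ c d, P c d := by
    intro P h c d
    obtain ⟨c, rfl⟩ := residue_surjective c
    obtain ⟨d, rfl⟩ := residue_surjective d
    exact h c d
  refine Rep.nonempty_iso_repW (V := (F hΛ).obj X) v w ?_ (hrep ?_) ?_ hst.le (hrep ?_) (hrep ?_)
  · intro x
    obtain ⟨⟨x, hx⟩, rfl⟩ := Submodule.Quotient.mk_surjective _ x
    obtain ⟨_, ha, z, hz, hxz⟩ := Submodule.mem_sup.mp hx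
    obtain ⟨d, rfl⟩ := memA.mp ha
    obtain ⟨y, z, rfl⟩ := mk_surj z
    obtain ⟨⟨y, rfl⟩, ⟨z, rfl⟩⟩ := mem_soc.mp hz
    -- The element is `d` times the generator of `A` plus `(p ^ (t-1) y, p ^ (s-1) z)`. The first
    -- coordinate of the latter lies in `A⁻`; the sign is that in the choice of `v`.
    refine ⟨residue Λ (-z), residue Λ d, (comb _ _).trans ((X.toTotal_eq_iff _ hx).mpr ?_)⟩
    rw [← hxz, add_mk, sub_mk]
    refine mem_minus.mpr ⟨⟨-y, by ring⟩, ?_⟩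
    ring_nf
    simp
  · intro c d h
    have h2 := (X.toTotal_eq_zero_iff (el_plus c d)).mp ((comb c d).symm.trans h)
    obtain ⟨h3, h4⟩ := el_minus.mp h2
    exact ⟨pdvd.mpr ((dvd_sub_right h3).mp h4), pdvd.mpr h3⟩
  · intro i hi hin
    refine hrep fun c d => (hmem _ c d).trans ?_
    change el c d ∈ SubPair.radPow Λ X.B i ⊔ X.minus ↔ _
    have hcd : residue Λ c = residue Λ d ↔ p ∣ d - c := by
      rw [eq_comm, ← sub_eq_zero, ← map_sub, pdvd]
    rw [hcd, pdvd, pdvd]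
    rcases le_or_gt i (t - 2) with h | h
    · rw [sup_eq_left.mpr (minus_le_rad (by omega)), mem_rad (by omega)]
      simp only [h, true_or, and_true]
      have h5 : p ^ i ∣ d * p ^ (t - 2) := (pow_dvd_pow p h).mul_left d
      simp only [h5, true_and]
      rcases le_or_gt i (s - 1) with h6 | h6
      · simp only [h6, true_or, iff_true]
        exact (pow_dvd_pow p ((min_le_left _ _).trans h6)).mul_left _
      · rw [min_eq_right (by omega), dvd_s]
        simp [not_le.mpr h6]
    · simp only [not_le.mpr h, not_le.mpr (hst.trans h), false_or]
      -- For `i ≥ t - 1` the crude bound by `rad^{t-1}` suffices, since it already forces both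
      -- coefficients to vanish.
      have h6 : SubPair.radPow Λ X.B i ⊔ X.minus ≤ SubPair.radPow Λ X.B (t - 1) :=
        sup_le (Submodule.smul_mono_left (Ideal.pow_le_pow_right (by omega)))
          (minus_le_rad le_rfl)
      constructor
      · intro h7
        obtain ⟨h8, h9⟩ := (mem_rad (by omega)).mp (h6 h7)
        rw [dvd_t hts] at h8
        rw [min_eq_right (by omega), dvd_s] at h9
        exact ⟨h9, (dvd_sub_right h8).mp h9, h8⟩
      · rintro ⟨h7, -, h8⟩
        exact Submodule.mem_sup_right (el_minus.mpr ⟨h8, h7⟩)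
  · refine fun c d => (hmem _ c d).trans ?_
    change el c d ∈ SubPair.soc Λ X.B ⊔ X.minus ↔ _
    rw [sup_eq_left.mpr minus_le_soc, mem_soc, dvd_t hts, pdvd]
    simp
  · refine fun c d => (hmem _ c d).trans ?_
    change el c d ∈ X.A ⊔ X.minus ↔ _
    rw [sup_eq_left.mpr X.minus_le, memA, pdvd]
    constructor
    -- The two coordinates say `e ≡ d` and `e ≡ d - c` modulo `p`; subtract.
    · rintro ⟨e, he⟩
      obtain ⟨h3, h4⟩ := mk_eq.mp he
      rw [← sub_mul] at h3 h4
      rw [dvd_s] at h4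
      have h5 := (dvd_t hts).mp ((pow_dvd_pow p (by omega : t - 1 ≤ t)).trans h3)
      have := dvd_sub h4 h5
      ring_nf at this
      exact this
    · intro h
      refine ⟨d, mk_eq.mpr ⟨by simp, ?_⟩⟩
      rw [← sub_mul, dvd_s]
      simpa using h

end Functor

/-! ### Existence of a listed direct summand -/

namespace Rep

variable {k : Type u} [Field k] {n : ℕ}

theorem exists_dual_eq_one {E : Type*} [AddCommGroup E] [Module k E] {N : Submodule k E} {x : E}
    (hx : x ∉ N) : ∃ φ : E →ₗ[k] k, φ x = 1 ∧ ∀ v ∈ N, φ v = 0 := by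
  obtain ⟨f, hf, hN⟩ := Submodule.exists_le_ker_of_notMem hx
  refine ⟨(f x)⁻¹ • f, inv_mul_cancel₀ hf, fun v hv => ?_⟩
  rw [LinearMap.smul_apply, LinearMap.mem_ker.mp (hN hv), smul_zero]

/-- The vector `x` is the inclusion and `φ` the projection. At each point the summand is the whole
line, and `x` must lie in the subspace, or it is zero, and `φ` must kill the subspace. -/
theorem exists_section_repV {V : Rep k n} {ℓ : ℕ} {a b : Fin 2} (x : V.V) (φ : V.V →ₗ[k] k)
    (hφ : φ x = 1)
    (hchain : ∀ i h1 h2, (i ≤ ℓ → x ∈ V.sub (.chain i h1 h2)) ∧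
      (¬ i ≤ ℓ → ∀ v ∈ V.sub (.chain i h1 h2), φ v = 0))
    (hprime : (a = 1 → x ∈ V.sub .prime) ∧ (a ≠ 1 → ∀ v ∈ V.sub .prime, φ v = 0))
    (hdprime : (b = 1 → x ∈ V.sub .dprime) ∧ (b ≠ 1 → ∀ v ∈ V.sub .dprime, φ v = 0)) :
    ∃ (ι : repV k n ℓ a b ⟶ V) (π : V ⟶ repV k n ℓ a b), ι ≫ π = 𝟙 _ := by
  let f : k →ₗ[k] V.V := LinearMap.toSpanSingleton k V.V x
  have key1 : ∀ (P : Prop) [Decidable P] (i : Poset n), (P → x ∈ V.sub i) →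
      ∀ c ∈ (if P then ⊤ else ⊥ : Submodule k k), f c ∈ V.sub i := by
    intro P _ i h c hc
    split_ifs at hc with hP
    · exact (V.sub i).smul_mem c (h hP)
    · rw [(Submodule.mem_bot k).mp hc, map_zero]
      exact (V.sub i).zero_mem
  have key2 : ∀ (P : Prop) [Decidable P] (i : Poset n), (¬ P → ∀ v ∈ V.sub i, φ v = 0) →
      ∀ v ∈ V.sub i, φ v ∈ (if P then ⊤ else ⊥ : Submodule k k) := by
    intro P _ i h v hv
    split_ifs with hP
    · trivial
    · exact (Submodule.mem_bot k).mpr (h hP v hv)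
  refine ⟨ofLinear (V := repV k n ℓ a b) f ?_, ofLinear (W := repV k n ℓ a b) φ ?_, ?_⟩
  · rintro (⟨i, h1, h2⟩ | _ | _)
    · exact key1 _ _ (hchain i h1 h2).1
    · exact key1 _ _ hprime.1
    · exact key1 _ _ hdprime.1
  · rintro (⟨i, h1, h2⟩ | _ | _)
    · exact key2 _ _ (hchain i h1 h2).2
    · exact key2 _ _ hprime.2
    · exact key2 _ _ hdprime.2
  · ext (c : k)
    change φ (c • x) = c
    rw [map_smul, hφ, smul_eq_mul, mul_one]

/-- The inclusion sends the standard basis to `x`, `y`, and `(φ, ψ)` is the projection; agreement of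
`φ` and `ψ` means landing in the diagonal. -/
theorem exists_section_repW {V : Rep k n} {s t : ℕ} (x y : V.V) (φ ψ : V.V →ₗ[k] k)
    (hφx : φ x = 1) (hφy : φ y = 0) (hψx : ψ x = 0) (hψy : ψ y = 1)
    (hs : ∀ i h1 h2, i ≤ s → x ∈ V.sub (.chain i h1 h2) ∧ y ∈ V.sub (.chain i h1 h2))
    (ht : ∀ i h1 h2, i ≤ t → x + y ∈ V.sub (.chain i h1 h2))
    (hs' : ∀ i h1 h2, ¬ i ≤ s → ∀ v ∈ V.sub (.chain i h1 h2), φ v = ψ v)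
    (ht' : ∀ i h1 h2, ¬ i ≤ t → V.sub (.chain i h1 h2) = ⊥)
    (hx : x ∈ V.sub .prime) (hψ : ∀ v ∈ V.sub .prime, ψ v = 0)
    (hy : y ∈ V.sub .dprime) (hφ : ∀ v ∈ V.sub .dprime, φ v = 0) :
    ∃ (ι : repW k n s t ⟶ V) (π : V ⟶ repW k n s t), ι ≫ π = 𝟙 _ := by
  let f : k × k →ₗ[k] V.V :=
    (LinearMap.toSpanSingleton k V.V x).coprod (LinearMap.toSpanSingleton k V.V y)
  refine ⟨ofLinear (V := repW k n s t) f ?_, ofLinear (W := repW k n s t) (φ.prod ψ) ?_, ?_⟩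
  · rintro (⟨i, h1, h2⟩ | _ | _) ⟨c, d⟩ hcd
    · change (c, d) ∈ (if i ≤ s then ⊤ else
        if i ≤ t then Submodule.span k {((1, 1) : k × k)} else ⊥ : Submodule k (k × k)) at hcd
      change c • x + d • y ∈ V.sub _
      split_ifs at hcd with his hit
      · exact (V.sub _).add_mem ((V.sub _).smul_mem c (hs i h1 h2 his).1)
          ((V.sub _).smul_mem d (hs i h1 h2 his).2)
      · obtain ⟨e, he⟩ := Submodule.mem_span_singleton.mp hcd
        obtain ⟨rfl, rfl⟩ : e = c ∧ e = d := by simpa using he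
        rw [← smul_add]
        exact (V.sub _).smul_mem e (ht i h1 h2 hit)
      · obtain ⟨rfl, rfl⟩ : c = 0 ∧ d = 0 := by simpa using hcd
        rw [zero_smul, zero_smul, add_zero]
        exact (V.sub _).zero_mem
    · obtain rfl : d = 0 := hcd.2
      change c • x + (0 : k) • y ∈ V.sub _
      rw [zero_smul, add_zero]
      exact (V.sub _).smul_mem c hx
    · obtain rfl : c = 0 := hcd.1
      change (0 : k) • x + d • y ∈ V.sub _
      rw [zero_smul, zero_add]
      exact (V.sub _).smul_mem d hy
  · rintro (⟨i, h1, h2⟩ | _ | _) v hv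
    · change (φ v, ψ v) ∈ (if i ≤ s then ⊤ else
        if i ≤ t then Submodule.span k {((1, 1) : k × k)} else ⊥ : Submodule k (k × k))
      split_ifs with his hit
      · trivial
      · rw [hs' i h1 h2 his v hv]
        exact Submodule.mem_span_singleton.mpr ⟨ψ v, by simp⟩
      · rw [ht' i h1 h2 hit, Submodule.mem_bot] at hv
        simp [hv]
    · exact ⟨trivial, hψ v hv⟩
    · exact ⟨hφ v hv, trivial⟩
  · ext (c : k × k)
    change (φ (c.1 • x + c.2 • y), ψ (c.1 • x + c.2 • y)) = c
    simp [hφx, hφy, hψx, hψy]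

theorem level_zero (V : Rep k n) : V.level 0 = ⊤ := dif_neg (by omega)

theorem level_eq (V : Rep k n) {i : ℕ} (h1 : 1 ≤ i) (h2 : i < n) :
    V.level i = V.sub (.chain i h1 h2) := dif_pos ⟨h1, h2⟩

theorem level_anti (V : Rep k n) {i j : ℕ} (hij : i ≤ j) (hj : j < n) :
    V.level j ≤ V.level i := by
  rcases Nat.eq_zero_or_pos i with rfl | hi
  · rw [level_zero]; exact le_top
  · rw [V.level_eq hi (by omega), V.level_eq (hi.trans_le hij) hj]
    exact V.sub.monotone hij

/-- Every nonzero object of `rep'` has one of the listed indecomposable direct summands. -/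
theorem exists_section_of_restricted (hn : 1 ≤ n) {V : Rep k n} (hV : restricted k n V)
    (hV0 : Nontrivial V.V) :
    ∃ (S : Rep k n) (ι : S ⟶ V) (π : V ⟶ S), ι ≫ π = 𝟙 S ∧
      ((∃ ℓ b, ℓ < n ∧ S = repV k n ℓ 1 b) ∨ (∃ ℓ, ℓ + 1 < n ∧ S = repV k n ℓ 0 1) ∨
        ∃ s t, s < t ∧ t + 1 < n ∧ S = repW k n s t) := by
  classical
  obtain ⟨hlast, hsup⟩ := hV
  set V' := V.sub .prime
  set V'' := V.sub .dprime
  -- The last nonzero term of the chain; it exists because level `0` is the total space.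
  let t := Nat.findGreatest (fun i => V.level i ≠ ⊥) (n - 1)
  have htn : t ≤ n - 1 := Nat.findGreatest_le _
  have ht : V.level t ≠ ⊥ :=
    Nat.findGreatest_spec (P := fun i => V.level i ≠ ⊥) (Nat.zero_le _)
      (by rw [level_zero]; exact top_ne_bot)
  have ht' : ∀ i h1 h2, ¬ i ≤ t → V.sub (.chain i h1 h2) = ⊥ := by
    intro i h1 h2 hi
    rw [← V.level_eq h1 h2]
    exact not_not.mp (Nat.findGreatest_is_greatest (not_le.mp hi) (by omega))
  have hle : ∀ {x j}, x ∈ V.level j → j < n → ∀ i h1 h2, i ≤ j → x ∈ V.sub (.chain i h1 h2) := by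
    intro x j hx hj i h1 h2 hi
    rw [← V.level_eq h1 h2]
    exact V.level_anti hi hj hx
  have hkill : ∀ (φ : V.V →ₗ[k] k) i h1 h2, ¬ i ≤ t →
      ∀ v ∈ V.sub (.chain i h1 h2), φ v = 0 := by
    intro φ i h1 h2 hi v hv
    rw [ht' i h1 h2 hi, Submodule.mem_bot] at hv
    rw [hv, map_zero]
  by_cases ha : V.level t ⊓ V' = ⊥
  swap
  · obtain ⟨x, ⟨hxt, hx'⟩, hx0⟩ := Submodule.exists_mem_ne_zero_of_ne_bot ha
    by_cases hx'' : x ∈ V''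
    · obtain ⟨φ, hφ, -⟩ := exists_dual_eq_one (k := k) (N := ⊥) (x := x) hx0
      obtain ⟨ι, π, h⟩ := exists_section_repV (ℓ := t) (a := 1) (b := 1) x φ hφ
        (fun i h1 h2 => ⟨hle hxt (by omega) i h1 h2, hkill φ i h1 h2⟩)
        ⟨fun _ => hx', fun h => absurd rfl h⟩ ⟨fun _ => hx'', fun h => absurd rfl h⟩
      exact ⟨_, ι, π, h, Or.inl ⟨t, 1, by omega, rfl⟩⟩
    · obtain ⟨φ, hφ, hφ''⟩ := exists_dual_eq_one hx''
      obtain ⟨ι, π, h⟩ := exists_section_repV (ℓ := t) (a := 1) (b := 0) x φ hφ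
        (fun i h1 h2 => ⟨hle hxt (by omega) i h1 h2, hkill φ i h1 h2⟩)
        ⟨fun _ => hx', fun h => absurd rfl h⟩ ⟨fun h => absurd h (by decide), fun _ => hφ''⟩
      exact ⟨_, ι, π, h, Or.inl ⟨t, 0, by omega, rfl⟩⟩
  -- The condition `V^{n-1} ⊆ V'` enters here: it is incompatible with `t = n - 1`, as `V^t` is
  -- nonzero and meets `V'` in zero.
  have htn' : t + 1 < n := by
    by_contra h
    have h1 : t = n - 1 := by omega
    rw [← h1] at hlast
    exact ht (by rw [← ha, inf_eq_left.mpr hlast])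
  have hdisj : ∀ {x}, x ∈ V.level t → x ∈ V' → x = 0 := fun h1 h2 =>
    (Submodule.mem_bot k).mp (ha ▸ Submodule.mem_inf.mpr ⟨h1, h2⟩)
  by_cases hb : V.level t ⊓ V'' = ⊥
  swap
  · obtain ⟨x, ⟨hxt, hx''⟩, hx0⟩ := Submodule.exists_mem_ne_zero_of_ne_bot hb
    have hx' : x ∉ V' := fun h => hx0 (hdisj hxt h)
    obtain ⟨φ, hφ, hφ'⟩ := exists_dual_eq_one hx'
    obtain ⟨ι, π, h⟩ := exists_section_repV (ℓ := t) (a := 0) (b := 1) x φ hφ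
      (fun i h1 h2 => ⟨hle hxt (by omega) i h1 h2, hkill φ i h1 h2⟩)
      ⟨fun h => absurd h (by decide), fun _ => hφ'⟩ ⟨fun _ => hx'', fun h => absurd rfl h⟩
    exact ⟨_, ι, π, h, Or.inr (Or.inl ⟨t, htn', rfl⟩)⟩
  obtain ⟨x, hxt, hx0⟩ := Submodule.exists_mem_ne_zero_of_ne_bot ht
  have hx'' : x ∉ V'' := fun h =>
    hx0 ((Submodule.mem_bot k).mp (hb ▸ Submodule.mem_inf.mpr ⟨hxt, h⟩))
  -- The depth in the chain that the `V'`-part of a decomposition of `x` can reach; `s` will be the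
  -- maximal one.
  let P : ℕ → Prop := fun i => ∃ y ∈ V', y ∈ V.level i ∧ x - y ∈ V''
  have hP0 : P 0 := by
    have : x ∈ V' ⊔ V'' := by rw [hsup]; trivial
    obtain ⟨y, hy, z, hz, rfl⟩ := Submodule.mem_sup.mp this
    exact ⟨y, hy, by rw [level_zero]; trivial, by rwa [add_sub_cancel_left]⟩
  let s := Nat.findGreatest P (n - 1)
  have hsn : s ≤ n - 1 := Nat.findGreatest_le _
  obtain ⟨y, hy', hys, hxy⟩ : P s := Nat.findGreatest_spec (Nat.zero_le _) hP0
  -- A `V'`-part lying in `V^t` would be zero, which would put `x` into `V''`.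
  have hst : s < t := by
    by_contra h
    have := hdisj (V.level_anti (not_lt.mp h) (by omega) hys) hy'
    rw [this, sub_zero] at hxy
    exact hx'' hxy
  -- If `y = a + b` with `a ∈ V' ∩ V''` and `b ∈ V^{s+1}`, then `b` would be a deeper `V'`-part of
  -- `x`.
  have hyN : y ∉ V' ⊓ V'' ⊔ V.level (s + 1) := by
    intro h
    obtain ⟨a, ⟨ha', ha''⟩, b, hb, hab⟩ := Submodule.mem_sup.mp h
    refine Nat.findGreatest_is_greatest (P := P) (Nat.lt_succ_self s) (by omega)
      ⟨b, ?_, hb, ?_⟩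
    · rw [show b = y - a by rw [← hab, add_sub_cancel_left]]
      exact V'.sub_mem hy' ha'
    · rw [show x - b = (x - y) + a by rw [← hab]; abel]
      exact V''.add_mem hxy ha''
  obtain ⟨θ, hθy, hθ⟩ := exists_dual_eq_one hyN
  have hθ1 : ∀ v, v ∈ V' → v ∈ V'' → θ v = 0 := fun v h1 h2 =>
    hθ v (Submodule.mem_sup_left ⟨h1, h2⟩)
  have hθ2 : ∀ v ∈ V.level (s + 1), θ v = 0 := fun v h => hθ v (Submodule.mem_sup_right h)
  let σ : V' × V'' →ₗ[k] V.V := V'.subtype.coprod V''.subtype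
  have hσ : LinearMap.range σ = ⊤ := by
    rw [LinearMap.range_coprod, Submodule.range_subtype, Submodule.range_subtype, hsup]
  obtain ⟨g, hg⟩ := LinearMap.exists_rightInverse_of_surjective σ hσ
  have hgv : ∀ v, ((g v).1 : V.V) + ((g v).2 : V.V) = v := fun v => LinearMap.congr_fun hg v
  -- `φ` applies `θ` to a chosen `V'`-part. As `θ` kills `V' ∩ V''`, it equals `θ` on `V'` and
  -- vanishes on `V''`. Hence `φ - θ` vanishes on `V'` and agrees with `φ` on `V^{s+1}`, where `θ =
  -- 0`.
  let φ : V.V →ₗ[k] k := θ.comp (V'.subtype.comp ((LinearMap.fst k V' V'').comp g))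
  have hφ : ∀ v, φ v = θ ((g v).1 : V.V) := fun _ => rfl
  have hφ'' : ∀ v ∈ V'', φ v = 0 := by
    intro v hv
    refine (hφ v).trans (hθ1 _ (g v).1.2 ?_)
    rw [eq_sub_iff_add_eq.mpr (hgv v)]
    exact V''.sub_mem hv (g v).2.2
  have hφ' : ∀ v ∈ V', φ v = θ v := by
    intro v hv
    have h2 : ((g v).2 : V.V) ∈ V' := by
      rw [eq_sub_iff_add_eq'.mpr (hgv v)]
      exact V'.sub_mem hv (g v).1.2
    conv_rhs => rw [← hgv v]
    rw [map_add, hθ1 _ h2 (g v).2.2, add_zero, hφ]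
  have hθx : θ x = 0 := hθ2 x (V.level_anti hst (by omega) hxt)
  obtain ⟨ι, π, h⟩ := exists_section_repW (s := s) (t := t) y (x - y) φ (φ - θ)
    ((hφ' y hy').trans hθy) (hφ'' _ hxy)
    (by rw [LinearMap.sub_apply, hφ' y hy', sub_self])
    (by rw [LinearMap.sub_apply, hφ'' _ hxy, map_sub, hθx, hθy]; ring)
    (fun i h1 h2 hi => ⟨hle hys (by omega) i h1 h2 hi,
      (V.sub _).sub_mem (hle hxt (by omega) i h1 h2 (by omega)) (hle hys (by omega) i h1 h2 hi)⟩)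
    (fun i h1 h2 hi => by
      rw [add_sub_cancel]
      exact hle hxt (by omega) i h1 h2 hi)
    (fun i h1 h2 hi v hv => by
      rw [← V.level_eq h1 h2] at hv
      rw [LinearMap.sub_apply, hθ2 v (V.level_anti (by omega) h2 hv), sub_zero])
    ht' hy' (fun v hv => by rw [LinearMap.sub_apply, hφ' v hv, sub_self]) hxy hφ''
  exact ⟨_, ι, π, h, Or.inr (Or.inr ⟨s, t, hst, htn', rfl⟩)⟩

/-! ### Invariants of the listed representations -/

theorem finrank_ite (P : Prop) [Decidable P] :
    Module.finrank k (if P then ⊤ else ⊥ : Submodule k k) = if P then 1 else 0 := by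
  by_cases h : P
  · rw [if_pos h, if_pos h, finrank_top, Module.finrank_self]
  · rw [if_neg h, if_neg h, finrank_bot]

theorem eq_of_repV_iso {ℓ ℓ' : ℕ} {a b a' b' : Fin 2}
    (f : repV k n ℓ a b ≅ repV k n ℓ' a' b') :
    (a = 1 ↔ a' = 1) ∧ (b = 1 ↔ b' = 1) ∧ ∀ i, 1 ≤ i → i < n → (i ≤ ℓ ↔ i ≤ ℓ') := by
  have key : ∀ {P Q : Prop} [Decidable P] [Decidable Q],
      Module.finrank k (if P then ⊤ else ⊥ : Submodule k k) =
        Module.finrank k (if Q then ⊤ else ⊥ : Submodule k k) → (P ↔ Q) := by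
    intro P Q _ _ h
    rw [finrank_ite, finrank_ite] at h
    split_ifs at h <;> simp_all
  exact ⟨key (finrank_sub_eq f .prime), key (finrank_sub_eq f .dprime),
    fun i h1 h2 => key (finrank_sub_eq f (.chain i h1 h2))⟩

/-- Along the chain the dimension drops from 2 to 1 after `s` and from 1 to 0 after `t`; comparison
at `t`, `t'` and then at the larger of `s`, `s'` detects any difference. -/
theorem eq_of_repW_iso {s t s' t' : ℕ} (hst : s < t) (ht : t < n) (hst' : s' < t') (ht' : t' < n)
    (f : repW k n s t ≅ repW k n s' t') : s = s' ∧ t = t' := by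
  have hdim : ∀ s t i : ℕ, Module.finrank k (if i ≤ s then ⊤ else
      if i ≤ t then Submodule.span k {((1, 1) : k × k)} else ⊥ : Submodule k (k × k)) =
      if i ≤ s then 2 else if i ≤ t then 1 else 0 := by
    intro s t i
    rcases le_or_gt i s with hs | hs
    · rw [if_pos hs, if_pos hs, finrank_top, Module.finrank_prod, Module.finrank_self]
    rw [if_neg hs.not_ge, if_neg hs.not_ge]
    rcases le_or_gt i t with ht | ht
    · rw [if_pos ht, if_pos ht]
      exact finrank_span_singleton (by simp)
    · rw [if_neg ht.not_ge, if_neg ht.not_ge, finrank_bot]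
  have key : ∀ i, 1 ≤ i → i < n → (if i ≤ s then 2 else if i ≤ t then 1 else 0) =
      (if i ≤ s' then 2 else if i ≤ t' then 1 else 0) := fun i h1 h2 =>
    (hdim s t i).symm.trans ((finrank_sub_eq f (.chain i h1 h2)).trans (hdim s' t' i))
  have h1 := key t (by omega) ht
  have h2 := key t' (by omega) ht'
  have htt : t = t' := by split_ifs at h1 h2 <;> omega
  subst htt
  refine ⟨?_, rfl⟩
  rcases lt_trichotomy s s' with h | h | h
  · have := key s' (by omega) (by omega)
    split_ifs at this <;> omega
  · exact h
  · have := key s (by omega) (by omega)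
    split_ifs at this <;> omega

theorem isEmpty_repV_iso_repW {ℓ s t : ℕ} {a b : Fin 2} :
    IsEmpty (repV k n ℓ a b ≅ repW k n s t) := by
  refine ⟨fun f => ?_⟩
  have h : Module.finrank k k = Module.finrank k (k × k) := finrank_eq f
  rw [Module.finrank_prod, Module.finrank_self] at h
  omega

end Rep

/-! ### Density, and the classification transported to pairs -/

section Main

variable {Λ : Type u} [CommRing Λ] [IsLocalRing Λ] {n : ℕ} {p : Λ}

theorem IsUniserialOfLength.one_le (hΛ : IsUniserialOfLength Λ n) : 1 ≤ n := by
  have h : 0 < Module.length Λ Λ := Module.length_pos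
  rw [hΛ.length_eq] at h
  exact_mod_cast h

theorem nonempty_F_picket_zero_iso (hΛ : IsUniserialOfLength Λ n)
    (hp : maximalIdeal Λ = Ideal.span {p}) {ℓ : ℕ} (h1 : 1 ≤ ℓ) (hn : ℓ ≤ n) :
    Nonempty ((F hΛ).obj (SubPair.picket hp ℓ 0 (M := 2) (by omega)) ≅
      Rep.repV (ResidueField Λ) n (ℓ - 1) 1 0) :=
  nonempty_F_picket_iso hΛ hp h1 hn _ (by omega) (by simp) (by simp; omega)

theorem nonempty_F_picket_one_iso (hΛ : IsUniserialOfLength Λ n)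
    (hp : maximalIdeal Λ = Ideal.span {p}) {ℓ : ℕ} (h1 : 1 ≤ ℓ) (hn : ℓ ≤ n) :
    Nonempty ((F hΛ).obj (SubPair.picket hp ℓ 1 (M := 2) (by omega)) ≅
      Rep.repV (ResidueField Λ) n (ℓ - 1) 1 1) :=
  nonempty_F_picket_iso hΛ hp h1 hn _ (by omega) (by simp) (by simp)

theorem nonempty_F_picket_two_iso (hΛ : IsUniserialOfLength Λ n)
    (hp : maximalIdeal Λ = Ideal.span {p}) {ℓ : ℕ} (h1 : 2 ≤ ℓ) (hn : ℓ ≤ n) :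
    Nonempty ((F hΛ).obj (SubPair.picket hp ℓ 2 (M := 2) (by omega)) ≅
      Rep.repV (ResidueField Λ) n (ℓ - 2) 0 1) :=
  nonempty_F_picket_iso hΛ hp (by omega) hn _ (by omega) (by simp; omega) (by simp)

/-- The representation corresponding to a picket or to a pair `Q^t_s`. -/
def SubPair.Index.rep (k : Type u) [Field k] : SubPair.Index n → Rep k n
  | .picket ℓ m _ _ _ _ =>
    Rep.repV k n (min (ℓ - m) (ℓ - 1)) (if m = 2 then 0 else 1) (if m = 0 then 0 else 1)
  | .pairQ t s _ _ _ => Rep.repW k n (s - 1) (t - 2)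

theorem nonempty_F_ofIndex_iso (hΛ : IsUniserialOfLength Λ n)
    (hp : maximalIdeal Λ = Ideal.span {p}) (x : SubPair.Index n) :
    Nonempty ((F hΛ).obj (SubPair.ofIndex hp x) ≅ x.rep (ResidueField Λ)) := by
  cases x with
  | picket ℓ m h1 hn hm h2 =>
    refine nonempty_F_picket_iso hΛ hp h1 hn h2 rfl ?_ ?_
    · split_ifs with h
      · simp; omega
      · simp; omega
    · split_ifs with h
      · simp; omega
      · simp; omega
  | pairQ t s h1 hst hn => exact nonempty_F_pairQ_iso hΛ hp h1 hst hn

theorem indecomposable_rep (k : Type u) [Field k] (x : SubPair.Index n) :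
    Indecomposable (x.rep k) := by
  cases x with
  | picket => exact Rep.indecomposable_repV _ _ _
  | pairQ t s h1 hst hn => exact Rep.indecomposable_repW hst (by omega)

/-- For a picket, `V' = 0` exactly when `m = 2` and `V'' = 0` exactly when `m = 0`, so `m` is
recovered first; the length of the chain part then gives `ℓ`. -/
theorem eq_of_rep_iso (k : Type u) [Field k] {x y : SubPair.Index n} (f : x.rep k ≅ y.rep k) :
    x = y := by
  cases x with
  | picket ℓ m h1 hn hm h2 =>
    cases y with
    | picket ℓ' m' h1' hn' hm' h2' =>
      obtain ⟨ha, hb, hc⟩ := Rep.eq_of_repV_iso f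
      have hm : m = m' := by
        have e1 : (m = 2 ↔ m' = 2) := by
          split_ifs at ha <;> simp_all
        have e2 : (m = 0 ↔ m' = 0) := by
          split_ifs at hb <;> simp_all
        omega
      subst hm
      obtain rfl : ℓ = ℓ' := by
        rcases lt_trichotomy ℓ ℓ' with h | h | h
        · have := hc (min (ℓ' - m) (ℓ' - 1)) (by omega) (by omega)
          omega
        · exact h
        · have := hc (min (ℓ - m) (ℓ - 1)) (by omega) (by omega)
          omega
      rfl
    | pairQ => exact (Rep.isEmpty_repV_iso_repW.false f).elim
  | pairQ t s h1 hst hn =>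
    cases y with
    | picket => exact (Rep.isEmpty_repV_iso_repW.false f.symm).elim
    | pairQ t' s' h1' hst' hn' =>
      obtain ⟨e1, e2⟩ := Rep.eq_of_repW_iso hst (by omega) hst' (by omega) f
      obtain rfl : t = t' := by omega
      obtain rfl : s = s' := by omega
      rfl

theorem essImage_of_restricted (hΛ : IsUniserialOfLength Λ n)
    (hp : maximalIdeal Λ = Ideal.span {p}) (V : Rep (ResidueField Λ) n)
    (hV : Rep.restricted (ResidueField Λ) n V) : (F hΛ).essImage V := by
  induction hd : Module.finrank (ResidueField Λ) V.V using Nat.strong_induction_on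
    generalizing V with
  | _ d ih =>
    rcases subsingleton_or_nontrivial V.V with h0 | h0
    · let X : SubPair Λ 2 := { B := PUnit, A := ⊥, bounded := by simp }
      have hX : IsZero X := SubPair.isZero_iff.mpr (inferInstanceAs (Subsingleton PUnit))
      exact ⟨X, ⟨((F hΛ).map_isZero hX).iso (Rep.isZero_iff.mpr h0)⟩⟩
    obtain ⟨S, ι, π, h, hS⟩ := Rep.exists_section_of_restricted hΛ.one_le hV h0
    obtain ⟨e⟩ := Rep.nonempty_iso_biprod_of_section ι π h
    have hS1 : Nontrivial S.V ∧ (F hΛ).essImage S := by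
      -- The shifts by one and two invert the index formulas for the values of `F`; the bounds on
      -- the summands are exactly those needed for the pairs to exist.
      rcases hS with ⟨ℓ, b, hℓ, rfl⟩ | ⟨ℓ, hℓ, rfl⟩ | ⟨s, t, hst, ht, rfl⟩
      · refine ⟨inferInstanceAs (Nontrivial (ResidueField Λ)), ?_⟩
        fin_cases b
        · exact ⟨_, nonempty_F_picket_zero_iso hΛ hp (ℓ := ℓ + 1) (by omega) hℓ⟩
        · exact ⟨_, nonempty_F_picket_one_iso hΛ hp (ℓ := ℓ + 1) (by omega) hℓ⟩
      · exact ⟨inferInstanceAs (Nontrivial (ResidueField Λ)),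
          _, nonempty_F_picket_two_iso hΛ hp (ℓ := ℓ + 2) (by omega) hℓ⟩
      · exact ⟨inferInstanceAs (Nontrivial (ResidueField Λ × ResidueField Λ)),
          _, nonempty_F_pairQ_iso hΛ hp (s := s + 1) (t := t + 2) (by omega) (by omega) ht⟩
    obtain ⟨hSnt, X, ⟨eX⟩⟩ := hS1
    obtain ⟨Y, ⟨eY⟩⟩ := ih _ (hd ▸ Rep.finrank_restrict_ker_lt ι π h hSnt) _
      (Rep.restricted_restrict_ker ι π h hV) rfl
    have := preservesBinaryBiproducts_of_preservesBiproducts (F hΛ)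
    exact ⟨X ⊞ Y, ⟨(F hΛ).mapBiprod X Y ≪≫ biprod.mapIso eX eY ≪≫ e.symm⟩⟩

theorem essSurj_F' (hΛ : IsUniserialOfLength Λ n) (hp : maximalIdeal Λ = Ideal.span {p}) :
    (F' hΛ).EssSurj where
  mem_essImage V := by
    obtain ⟨X, ⟨e⟩⟩ := essImage_of_restricted hΛ hp V.obj V.property
    exact ⟨X, ⟨(Rep.restricted (ResidueField Λ) n).isoMk e⟩⟩

theorem indecomposable_ofIndex (hΛ : IsUniserialOfLength Λ n)
    (hp : maximalIdeal Λ = Ideal.span {p}) (x : SubPair.Index n) :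
    Indecomposable (SubPair.ofIndex hp x) := by
  obtain ⟨e⟩ := nonempty_F_ofIndex_iso hΛ hp x
  exact indecomposable_of_map (F hΛ) (isZero_of_F_obj hΛ)
    (indecomposable_of_iso e (indecomposable_rep _ x))

/-- Functoriality suffices: an isomorphism of pairs induces one of the listed representations. -/
theorem eq_of_ofIndex_iso (hΛ : IsUniserialOfLength Λ n) (hp : maximalIdeal Λ = Ideal.span {p})
    {x y : SubPair.Index n} (f : SubPair.ofIndex hp x ≅ SubPair.ofIndex hp y) : x = y := by
  obtain ⟨e⟩ := nonempty_F_ofIndex_iso hΛ hp x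
  obtain ⟨e'⟩ := nonempty_F_ofIndex_iso hΛ hp y
  exact eq_of_rep_iso (ResidueField Λ) (e.symm ≪≫ (F hΛ).mapIso f ≪≫ e')

end Main

end BoundedPairs

theorem mainTheorem6 {Λ : Type u} [CommRing Λ] [IsLocalRing Λ] (n : ℕ)
    (hΛ : IsUniserialOfLength Λ n) (p : Λ) (hp : maximalIdeal Λ = Ideal.span {p}) :
    -- the values of the functor on pickets and on the pairs `Q^t_s`
    (∀ ℓ, 1 ≤ ℓ → ℓ ≤ n →
      Nonempty ((F hΛ).obj (SubPair.picket hp ℓ 0 (M := 2) (by omega)) ≅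
        Rep.repV (ResidueField Λ) n (ℓ - 1) 1 0)) ∧
    (∀ ℓ, 1 ≤ ℓ → ℓ ≤ n →
      Nonempty ((F hΛ).obj (SubPair.picket hp ℓ 1 (M := 2) (by omega)) ≅
        Rep.repV (ResidueField Λ) n (ℓ - 1) 1 1)) ∧
    (∀ ℓ, 2 ≤ ℓ → ℓ ≤ n →
      Nonempty ((F hΛ).obj (SubPair.picket hp ℓ 2 (M := 2) (by omega)) ≅
        Rep.repV (ResidueField Λ) n (ℓ - 2) 0 1)) ∧
    (∀ s t, 1 ≤ s → s - 1 < t - 2 → t ≤ n →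
      Nonempty ((F hΛ).obj (SubPair.pairQ hp t s) ≅
        Rep.repW (ResidueField Λ) n (s - 1) (t - 2))) ∧
    -- these representations are indecomposable
    (∀ ℓ, 1 ≤ ℓ → ℓ ≤ n → Indecomposable (Rep.repV (ResidueField Λ) n (ℓ - 1) 1 0)) ∧
    (∀ ℓ, 1 ≤ ℓ → ℓ ≤ n → Indecomposable (Rep.repV (ResidueField Λ) n (ℓ - 1) 1 1)) ∧
    (∀ ℓ, 2 ≤ ℓ → ℓ ≤ n → Indecomposable (Rep.repV (ResidueField Λ) n (ℓ - 2) 0 1)) ∧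
    (∀ s t, 1 ≤ s → s - 1 < t - 2 → t ≤ n →
      Indecomposable (Rep.repW (ResidueField Λ) n (s - 1) (t - 2))) ∧
    -- density
    (F' hΛ).EssSurj ∧
    -- the pickets and the pairs `Q^t_s` are indecomposable and pairwise nonisomorphic
    (∀ x : SubPair.Index n, Indecomposable (SubPair.ofIndex hp x)) ∧
    (∀ x y : SubPair.Index n,
      Nonempty (SubPair.ofIndex hp x ≅ SubPair.ofIndex hp y) → x = y) := by
  exact ⟨fun _ h1 hn => nonempty_F_picket_zero_iso hΛ hp h1 hn,
    fun _ h1 hn => nonempty_F_picket_one_iso hΛ hp h1 hn,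
    fun _ h1 hn => nonempty_F_picket_two_iso hΛ hp h1 hn,
    fun _ _ h1 hst hn => nonempty_F_pairQ_iso hΛ hp h1 hst hn,
    fun _ _ _ => Rep.indecomposable_repV _ _ _,
    fun _ _ _ => Rep.indecomposable_repV _ _ _,
    fun _ _ _ => Rep.indecomposable_repV _ _ _,
    fun _ _ _ hst hn => Rep.indecomposable_repW hst (by omega),
    essSurj_F' hΛ hp, indecomposable_ofIndex hΛ hp,
    fun _ _ ⟨f⟩ => eq_of_ofIndex_iso hΛ hp f⟩
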